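/- Graphs are finite and may have loops and parallel edges. An \emph{immersion} of a graph $F$ in a graph $G$ is a map $\theta$ assigning to the vertices of $F$ pairwise distinct vertices of $G$, and to the edges of $F$ pairwise edge-disjoint connected subgraphs of $G$, such that if an edge $e$ of $F$ is incident with a vertex $v$, then $\theta(v)$ is a vertex of $\theta(e)$, and if $e$ is moreover a loop, then $\theta(e)$ contains a cycle passing through $\theta(v)$ (a loop is a cycle of length $1$, and two parallel edges form a cycle of length $2$). The immersion is \emph{strong} if, in addition, $\theta(e)$ does not contain $\theta(v)$ whenever $e \in E(F)$ is not incident with $v \in V(F)$. An \emph{edge cut} of $G$ is the set of all edges with exactly one end in $S$, for some $S \subseteq V(G)$; it separates $u$ from $v$ if exactly one of $u$ and $v$ belongs to $S$. Theorem. For every graph $F$ and every integer $m \ge 0$ there exists a constant $M$ such that the following holds. Let $G$ be a graph and let $X \subseteq V(G)$ be a nonempty set of vertices such that no two distinct vertices of $X$ are separated by an edge cut of size less than $M$ in $G$. Let $G_X$ be the simple graph with vertex set $X$ in which two distinct vertices $u, v \in X$ are adjacent if and only if $G$ contains $m$ pairwise edge-disjoint paths joining $u$ with $v$ and containing no vertex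 of $X$ other than $u$ and $v$. If $G$ does not contain $F$ as a strong immersion, then $G_X$ is connected. -/

import Mathlib

open scoped Graph

namespace Graph

universe u₁ u₂ u₃ u₄

/-- A walk in the multigraph `G`: an alternating sequence of vertices and edges. -/
inductive Walk {α : Type u₁} {β : Type u₂} (G : Graph α β) : α → α → Type (max u₁ u₂)
  | nil {u : α} (hu : u ∈ V(G)) : Walk G u u
  | cons {u v w : α} (e : β) (h : G.IsLink e u v) (p : Walk G v w) : Walk G u w

namespace Walk

variable {α : Type u₁} {β : Type u₂} {G : Graph α β}

/-- The list of vertices visited by a walk, in order. -/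
def support : {u v : α} → G.Walk u v → List α
  | u, _, nil _ => [u]
  | u, _, cons _ _ p => u :: p.support

/-- The list of edges traversed by a walk, in order. -/
def edges : {u v : α} → G.Walk u v → List β
  | _, _, nil _ => []
  | _, _, cons e _ p => e :: p.edges

/-- A path is a walk without repeated vertices. -/
def IsPath {u v : α} (p : G.Walk u v) : Prop := p.support.Nodup

/-- A cycle is a closed walk with at least one edge that repeats no edge, and no vertex except
that its first and last vertices coincide. A loop is a cycle of length `1` and two parallel edges
form a cycle of length `2`. -/
def IsCycle {u : α} (p : G.Walk u u) : Prop :=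
  p.edges ≠ [] ∧ p.edges.Nodup ∧ p.support.tail.Nodup

theorem exists_concat {u v w : α} (p : G.Walk u v) (e : β) (h : G.IsLink e v w) :
    ∃ q : G.Walk u w, q.support = p.support ++ [w] ∧ q.edges = p.edges ++ [e] := by
  induction p with
  | nil hu => exact ⟨cons e h (nil h.right_mem), rfl, rfl⟩
  | cons f hf p ih =>
    obtain ⟨q, h₁, h₂⟩ := ih h
    exact ⟨cons f hf q, by simp [support, h₁], by simp [edges, h₂]⟩

theorem exists_reverse {u v : α} (p : G.Walk u v) :
    ∃ q : G.Walk v u, q.support = p.support.reverse ∧ q.edges = p.edges.reverse := by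
  induction p with
  | nil hu => exact ⟨nil hu, rfl, rfl⟩
  | cons f hf p ih =>
    obtain ⟨q, h₁, h₂⟩ := ih
    obtain ⟨r, h₃, h₄⟩ := exists_concat q f hf.symm
    exact ⟨r, by simp [support, h₃, h₁], by simp [edges, h₄, h₂]⟩

end Walk

/-- A multigraph is connected if it has a vertex and any two of its vertices are joined by a
walk. -/
def IsConnected {α : Type u₁} {β : Type u₂} (G : Graph α β) : Prop :=
  V(G).Nonempty ∧ ∀ u ∈ V(G), ∀ v ∈ V(G), Nonempty (G.Walk u v)

/-- An immersion of `F` in `G`. Here `H ≤ G` says that `H` is a subgraph of `G`. -/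
structure Immersion {α : Type u₁} {β : Type u₂} {γ : Type u₃} {δ : Type u₄}
    (F : Graph α β) (G : Graph γ δ) where
  /-- The vertex of `G` assigned to a vertex of `F`. -/
  vert : V(F) → γ
  /-- The subgraph of `G` assigned to an edge of `F`. -/
  edge : E(F) → Graph γ δ
  vert_mem : ∀ v, vert v ∈ V(G)
  vert_injective : Function.Injective vert
  edge_le : ∀ e, edge e ≤ G
  edge_isConnected : ∀ e, (edge e).IsConnected
  edge_disjoint : ∀ e f, e ≠ f → Disjoint E(edge e) E(edge f)
  vert_mem_edge : ∀ (e : E(F)) (v : V(F)), F.Inc e v → vert v ∈ V(edge e)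
  exists_isCycle : ∀ (e : E(F)) (v : V(F)), F.IsLoopAt e v →
    ∃ C : (edge e).Walk (vert v) (vert v), C.IsCycle

/-- An immersion is strong if the subgraph assigned to an edge `e` avoids the vertices assigned
to the vertices not incident with `e`. -/
def Immersion.IsStrong {α : Type u₁} {β : Type u₂} {γ : Type u₃} {δ : Type u₄}
    {F : Graph α β} {G : Graph γ δ} (θ : F.Immersion G) : Prop :=
  ∀ (e : E(F)) (v : V(F)), ¬ F.Inc e v → θ.vert v ∉ V(θ.edge e)

/-- `F` appears in `G` as a strong immersion. -/
def IsStronglyImmersedIn {α : Type u₁} {β : Type u₂} {γ : Type u₃} {δ : Type u₄}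
    (F : Graph α β) (G : Graph γ δ) : Prop :=
  ∃ θ : F.Immersion G, θ.IsStrong

/-- The edge cut determined by a vertex set `S`: the edges with one end in `S` and the other end
outside `S`. -/
def edgeCut {α : Type u₁} {β : Type u₂} (G : Graph α β) (S : Set α) : Set β :=
  {e | ∃ x y, G.IsLink e x y ∧ x ∈ S ∧ y ∉ S}

/-- No two vertices of `X` are separated by an edge cut of size less than `M` in `G`. -/
def IsPairwiseEdgeConnected {α : Type u₁} {β : Type u₂} (G : Graph α β) (X : Set α) (M : ℕ) :
    Prop :=
  ∀ u ∈ X, ∀ v ∈ X, u ≠ v →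
    ¬ ∃ S ⊆ V(G), u ∈ S ∧ v ∉ S ∧ (G.edgeCut S).encard < M

/-- `G` contains `m` pairwise edge-disjoint paths joining `u` with `v` that are otherwise disjoint
from `X`. -/
def HasPathsAvoiding {α : Type u₁} {β : Type u₂} (G : Graph α β) (X : Set α) (m : ℕ) (u v : α) :
    Prop :=
  ∃ P : Fin m → G.Walk u v,
    (∀ i, (P i).IsPath) ∧
    (∀ i j, i ≠ j → List.Disjoint (P i).edges (P j).edges) ∧
    (∀ i, ∀ x ∈ (P i).support, x ∈ X → x = u ∨ x = v)

theorem HasPathsAvoiding.symm {α : Type u₁} {β : Type u₂} {G : Graph α β} {X : Set α} {m : ℕ}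
    {u v : α} (h : G.HasPathsAvoiding X m u v) : G.HasPathsAvoiding X m v u := by
  obtain ⟨P, h₁, h₂, h₃⟩ := h
  choose Q hs he using fun i => (P i).exists_reverse
  refine ⟨Q, fun i => ?_, fun i j hij => ?_, fun i x hx hX => ?_⟩
  · have h := h₁ i
    simpa [Walk.IsPath, hs] using h
  · have h := h₂ i j hij
    intro e h₄ h₅
    rw [he, List.mem_reverse] at h₄ h₅
    exact h h₄ h₅
  · rw [hs, List.mem_reverse] at hx
    exact (h₃ i x hx hX).symm

/-- The simple graph with vertex set `X` in which distinct `u, v ∈ X` are adjacent if `G` contains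
`m` pairwise edge-disjoint paths joining `u` with `v` and otherwise disjoint from `X`. -/
def pathGraph {α : Type u₁} {β : Type u₂} (G : Graph α β) (X : Set α) (m : ℕ) :
    SimpleGraph X where
  Adj u v := u ≠ v ∧ G.HasPathsAvoiding X m u v
  symm := ⟨fun _ _ h => ⟨h.1.symm, h.2.symm⟩⟩
  loopless := ⟨fun _ h => h.1 rfl⟩

end Graph

/-!
The proof reduces the multigraph `G` to an edge-weighted graph on `X` and finds there, if its
heavy pairs do not connect `X`, a flow pattern that contains every small graph.

*Flows.* A flow is an antisymmetric function on pairs of vertices. A real flow with integral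
outflows can be rounded to an integral one (`exists_integral_flow`), and an integral flow into a
single vertex decomposes into edge-disjoint paths (`exists_paths_of_flow`). So it is enough to
construct flows, even half-integral ones.

*Splitting off.* After every edge is doubled, all degrees are even, and Lovász's splitting argument
removes all vertices outside `X` without decreasing the cuts that separate `X` below `2 * M`
(`IsReduction.exists_supported`). This leaves a weight function on the pairs of vertices of `X` all
of whose cuts are large and whose flows can be realized in `G` at half their value
(`exists_weights`). A pair of weight at least `2 * m` is therefore an edge of the graph `G_X`, and
it remains to treat the case that these heavy pairs do not connect `X`.

*Stars.* A star (`HasStar`) is a flow that sends `k` units from each of `t` sources to a common hub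
and does not enter the sources. It yields paths from the sources to the hub, and every `F` with few
vertices and edges is strongly immersed in such a system of paths, the sources being the images of
the vertices (`isStronglyImmersedIn_of_paths`).

*Finding a star.* A vertex in many heavy pairs is the hub of a star. If two components of the graph
of heavy pairs have much weight between them, one of them has many vertices with an edge to the
other one; it is cut into `t` connected pieces each of which has many such vertices, and the other
component serves as the hub (`hasStar_of_boundary`). Otherwise any two components have bounded
weight between them, so the large cut around each component gives it many neighbouring components.
Mader's contraction argument then finds disjoint connected sets of components with `t + 1` common
neighbours, one set for each unit of flow (`exists_connected_of_adjPairs`), which again give a star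
(`hasStar_of_connected_components`).
-/

open scoped Graph

namespace StrongImmersion

/-! ### Simple directed paths and flows -/

section Flow

universe u

variable {V : Type u}

/-- `IsSimplePath r u v l` says that `l` is the list of vertices of a path from `u` to `v` without
repeated vertices, each of whose steps is in the relation `r`. -/
inductive IsSimplePath (r : V → V → Prop) : V → V → List V → Prop
  | nil (u : V) : IsSimplePath r u u [u]
  | cons {a b c : V} {l : List V} : r a b → IsSimplePath r b c l → a ∉ l →
      IsSimplePath r a c (a :: l)

namespace IsSimplePath

variable {r : V → V → Prop} {a b c : V} {l : List V}

lemma nodup (h : IsSimplePath r a b l) : l.Nodup := by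
  induction h with
  | nil u => simp
  | cons _ _ h ih => exact List.nodup_cons.2 ⟨h, ih⟩

lemma left_mem (h : IsSimplePath r a b l) : a ∈ l := by
  cases h <;> simp

lemma exists_suffix (h : IsSimplePath r b c l) (ha : a ∈ l) : ∃ l', IsSimplePath r a c l' := by
  induction h with
  | nil u => obtain rfl : a = u := by simpa using ha
             exact ⟨_, nil a⟩
  | @cons x y z l hxy hl hx ih =>
    rcases List.mem_cons.1 ha with rfl | ha
    · exact ⟨_, cons hxy hl hx⟩
    · exact ih ha

lemma exists_of_reflTransGen (h : Relation.ReflTransGen r a b) : ∃ l, IsSimplePath r a b l := by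
  induction h using Relation.ReflTransGen.head_induction_on with
  | refl => exact ⟨_, nil b⟩
  | @head x y hxy _ ih =>
    obtain ⟨l, hl⟩ := ih
    by_cases hx : x ∈ l
    · exact hl.exists_suffix hx
    · exact ⟨_, cons hxy hl hx⟩

end IsSimplePath

/-- A flow is an antisymmetric function on pairs of vertices. -/
def IsFlow {R : Type*} [Neg R] (f : V → V → R) : Prop := ∀ x y, f x y = - f y x

/-- The net amount that the flow `f` sends out of `x`. -/
def outflow [Fintype V] {R : Type*} [AddCommMonoid R] (f : V → V → R) (x : V) : R := ∑ y, f x y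

variable [DecidableEq V]

/-- The flow of value `1` along the arc from `a` to `b`; it is `0` if `a = b`. -/
def arc (a b : V) : V → V → ℤ :=
  fun x y => (if x = a ∧ y = b then 1 else 0) - (if x = b ∧ y = a then 1 else 0)

lemma isFlow_arc (a b : V) : IsFlow (arc a b) := by
  intro x y
  simp only [arc, and_comm]
  ring

/-- The net outflow of a unit flow from `a` to `b`. -/
def demand (a b : V) : V → ℤ := fun x => (if x = a then 1 else 0) - (if x = b then 1 else 0)

lemma outflow_arc [Fintype V] (a b x : V) : outflow (arc a b) x = demand a b x := by
  simp only [outflow, arc, demand, Finset.sum_sub_distrib, ite_and]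
  split_ifs <;> simp

/-- The flow of value `1` along a list of vertices. -/
def pathFlow : List V → V → V → ℤ
  | a :: b :: l => arc a b + pathFlow (b :: l)
  | _ => 0

lemma isFlow_pathFlow : ∀ l : List V, IsFlow (pathFlow l)
  | [] => by intro; simp [pathFlow]
  | [a] => by intro; simp [pathFlow]
  | a :: b :: l => by
    intro x y
    have h₁ := isFlow_arc a b x y
    have h₂ := isFlow_pathFlow (b :: l) x y
    simp only [pathFlow, Pi.add_apply]
    rw [h₁, h₂]
    ring

lemma pathFlow_eq_zero_left {x : V} : ∀ {l : List V}, x ∉ l → ∀ y, pathFlow l x y = 0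
  | [], _, _ => by simp [pathFlow]
  | [a], _, _ => by simp [pathFlow]
  | a :: b :: l, h, y => by
    have h₁ : x ∉ b :: l := fun h' => h (List.mem_cons_of_mem _ h')
    have h₂ := pathFlow_eq_zero_left h₁ y
    have ha : x ≠ a := fun h' => h (by simp [h'])
    have hb : x ≠ b := fun h' => h₁ (by simp [h'])
    simp [pathFlow, arc, ha, hb, h₂]

lemma pathFlow_eq_zero_right {x : V} {l : List V} (h : x ∉ l) (y : V) : pathFlow l y x = 0 := by
  rw [isFlow_pathFlow, pathFlow_eq_zero_left h, neg_zero]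

omit [DecidableEq V] in
lemma outflow_add [Fintype V] {R : Type*} [AddCommMonoid R] (f g : V → V → R) (x : V) :
    outflow (f + g) x = outflow f x + outflow g x := by
  simp [outflow, Finset.sum_add_distrib]

lemma outflow_pathFlow [Fintype V] {r : V → V → Prop} {a b : V} {l : List V}
    (h : IsSimplePath r a b l) (x : V) : outflow (pathFlow l) x = demand a b x := by
  induction h with
  | nil u => simp [pathFlow, outflow, demand]
  | @cons a b c l hab hl ha ih =>
    cases hl with
    | nil => rw [pathFlow, outflow_add, outflow_arc]; simp [pathFlow, outflow]
    | cons h₁ h₂ h₃ => rw [pathFlow, outflow_add, outflow_arc, ih]; simp [demand]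

/-- The steps of a simple path are the arcs that carry positive flow, and each carries `1`. -/
lemma pathFlow_spec {r : V → V → Prop} {a b : V} {l : List V}
    (h : IsSimplePath r a b l) (x y : V) :
    pathFlow l x y ≤ 1 ∧ (0 < pathFlow l x y → r x y) ∧ 0 ≤ pathFlow l a y := by
  induction h generalizing x y with
  | nil u => simp [pathFlow]
  | @cons a b c l hab hl ha ih =>
    have key : pathFlow (a :: l) = arc a b + pathFlow l := by
      cases hl <;> rfl
    have h0 : ∀ z, pathFlow l a z = 0 := pathFlow_eq_zero_left ha
    have h0' : ∀ z, pathFlow l z a = 0 := pathFlow_eq_zero_right ha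
    have hne : a ≠ b := fun h => ha (h ▸ hl.left_mem)
    obtain ⟨h₁, h₂, -⟩ := ih x y
    simp only [key, Pi.add_apply]
    refine ⟨?_, ?_, ?_⟩
    · by_cases hx : x = a
      · subst hx
        simp only [arc, h0]; split_ifs <;> simp_all
      · simp only [arc, hx, false_and, if_false]; split_ifs <;> omega
    · by_cases hx : x = a
      · subst hx
        simp only [arc, h0, hne, false_and, if_false]
        by_cases hy : y = b
        · subst hy; intro; exact hab
        · simp [hy]
      · simp only [arc, hx, false_and, if_false]
        intro h
        apply h₂
        split_ifs at h <;> omega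
    · simp only [arc, h0, hne, false_and, if_false]
      split_ifs <;> simp

lemma neg_one_le_pathFlow {r : V → V → Prop} {a b : V} {l : List V}
    (h : IsSimplePath r a b l) (x y : V) : -1 ≤ pathFlow l x y := by
  rw [isFlow_pathFlow]
  have := (pathFlow_spec h y x).1
  omega

/-- Inside a set the contributions of a flow cancel, so the total outflow is what crosses its
boundary. -/
lemma sum_outflow [Fintype V] {R : Type*} [AddCommGroup R] [IsAddTorsionFree R] {f : V → V → R}
    (hf : IsFlow f) (S : Finset V) :
    ∑ x ∈ S, outflow f x = ∑ x ∈ S, ∑ y ∈ Sᶜ, f x y := by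
  have h0 : ∑ x ∈ S, ∑ y ∈ S, f x y = 0 := by
    have : ∑ x ∈ S, ∑ y ∈ S, f x y = - ∑ x ∈ S, ∑ y ∈ S, f x y := by
      conv_lhs => rw [Finset.sum_comm]
      rw [← Finset.sum_neg_distrib]
      refine Finset.sum_congr rfl fun x _ => ?_
      rw [← Finset.sum_neg_distrib]
      exact Finset.sum_congr rfl fun y _ => hf y x
    exact self_eq_neg.1 this
  have : ∀ x, outflow f x = ∑ y ∈ S, f x y + ∑ y ∈ Sᶜ, f x y :=
    fun x => (Finset.sum_add_sum_compl S _).symm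
  simp only [this, Finset.sum_add_distrib, h0, zero_add]

end Flow

/-! ### Rounding of flows -/

section Rounding

universe u

variable {V : Type u} [Fintype V] [DecidableEq V]

omit [DecidableEq V] in
/-- Rounding up in one direction of each pair, and down in the other one, preserves antisymmetry. -/
lemma exists_isFlow_le_ceil (f : V → V → ℝ) (hf : IsFlow f) :
    ∃ g : V → V → ℤ, IsFlow g ∧ ∀ x y, g x y ≤ ⌈f x y⌉ := by
  let e := Fintype.equivFin V
  have hzero : ∀ x, f x x = 0 := fun x => self_eq_neg.1 (hf x x)
  refine ⟨fun x y => if e x < e y then ⌈f x y⌉ else ⌊f x y⌋, fun x y => ?_, fun x y => ?_⟩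
  · rcases lt_trichotomy (e x) (e y) with h | h | h
    · simp only [h, not_lt_of_gt h, if_true, if_false]
      rw [hf x y, Int.ceil_neg]
    · obtain rfl := e.injective h
      simp [hzero]
    · simp only [h, not_lt_of_gt h, if_true, if_false]
      rw [hf x y, Int.floor_neg]
  · dsimp only
    split_ifs
    · exact le_rfl
    · exact Int.floor_le_ceil _

/-- A real flow with integral outflows can be rounded to an integral flow with the same
outflows. Among the integral flows that respect the rounded capacities, one whose outflows deviate
least is taken; a remaining deviation could be decreased along an augmenting path, as the set
reachable in the residual relation is crossed at full capacity. -/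
theorem exists_integral_flow (f : V → V → ℝ) (hf : IsFlow f) (b : V → ℤ)
    (hb : ∀ x, outflow f x = b x) :
    ∃ g : V → V → ℤ, IsFlow g ∧ (∀ x y, g x y ≤ ⌈f x y⌉) ∧ ∀ x, outflow g x = b x := by
  classical
  let P : ℕ → Prop := fun n => ∃ g : V → V → ℤ, IsFlow g ∧ (∀ x y, g x y ≤ ⌈f x y⌉) ∧
    ∑ x, (outflow g x - b x).natAbs = n
  have hP : ∃ n, P n := by
    obtain ⟨g, h₁, h₂⟩ := exists_isFlow_le_ceil f hf
    exact ⟨_, g, h₁, h₂, rfl⟩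
  obtain ⟨g, hg, hle, hn⟩ := Nat.find_spec hP
  refine ⟨g, hg, hle, ?_⟩
  have hsumg : ∑ x, (outflow g x - b x) = 0 := by
    have h₁ := sum_outflow hg Finset.univ
    have h₂ := sum_outflow hf Finset.univ
    simp only [Finset.compl_univ, Finset.sum_empty, Finset.sum_const_zero, hb] at h₁ h₂
    rw [Finset.sum_sub_distrib, h₁]
    have : ((∑ x, b x : ℤ) : ℝ) = 0 := by push_cast; exact h₂
    have : ∑ x, b x = 0 := by exact_mod_cast this
    omega
  by_contra! hne
  obtain ⟨x₀, hx₀⟩ := hne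
  obtain ⟨x, hx⟩ : ∃ x, outflow g x - b x < 0 := by
    by_contra! h
    have := (Finset.sum_eq_zero_iff_of_nonneg (fun x _ => h x)).1 hsumg x₀ (Finset.mem_univ _)
    omega
  -- the residual relation of `g`
  let r : V → V → Prop := fun y z => g y z < ⌈f y z⌉
  let R : Finset V := Finset.univ.filter fun y => Relation.ReflTransGen r x y
  have hxR : x ∈ R := by simp [R, Relation.ReflTransGen.refl]
  obtain ⟨z, hzR, hz⟩ : ∃ z ∈ R, 0 < outflow g z - b z := by
    by_contra! h
    have h₁ : ∑ y ∈ R, (outflow g y - b y) < 0 :=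
      Finset.sum_neg' (fun y hy => h y hy) ⟨x, hxR, hx⟩
    have h₂ := sum_outflow hg R
    have h₃ := sum_outflow hf R
    have h₄ : ∑ y ∈ R, ∑ z ∈ Rᶜ, f y z ≤ ((∑ y ∈ R, ∑ z ∈ Rᶜ, g y z : ℤ) : ℝ) := by
      push_cast
      refine Finset.sum_le_sum fun y hy => Finset.sum_le_sum fun z hz => ?_
      have : ¬ g y z < ⌈f y z⌉ := by
        intro hlt
        apply Finset.mem_compl.1 hz
        simp only [R, Finset.mem_filter, Finset.mem_univ, true_and] at hy ⊢
        exact hy.tail hlt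
      exact Int.ceil_le.1 (not_lt.1 this)
    rw [← h₃, ← h₂] at h₄
    simp only [hb] at h₄
    have h₅ : ∑ y ∈ R, b y ≤ ∑ y ∈ R, outflow g y := by exact_mod_cast h₄
    rw [Finset.sum_sub_distrib] at h₁
    omega
  obtain ⟨l, hl⟩ := IsSimplePath.exists_of_reflTransGen
    (show Relation.ReflTransGen r x z by simpa [R] using hzR)
  have hlt : ∑ y, (outflow (g + pathFlow l) y - b y).natAbs < ∑ y, (outflow g y - b y).natAbs := by
    have hxz : x ≠ z := by rintro rfl; omega
    refine Finset.sum_lt_sum (fun y _ => ?_) ⟨x, Finset.mem_univ _, ?_⟩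
    · rw [outflow_add, outflow_pathFlow hl, demand]
      by_cases h₁ : y = x
      · subst h₁; simp only [hxz, if_true, if_false]; omega
      · by_cases h₂ : y = z
        · subst h₂; simp only [h₁, if_true, if_false]; omega
        · simp [h₁, h₂]
    · rw [outflow_add, outflow_pathFlow hl, demand]
      simp only [hxz, if_true, if_false]; omega
  rw [hn] at hlt
  refine Nat.find_min hP hlt ⟨g + pathFlow l, ?_, ?_, rfl⟩
  · intro y z
    have h₁ := hg y z
    have h₂ := isFlow_pathFlow l y z
    simp only [Pi.add_apply]; omega
  · intro y w
    have h₁ := hle y w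
    obtain ⟨h₂, h₃, -⟩ := pathFlow_spec hl y w
    simp only [Pi.add_apply]
    by_cases h : 0 < pathFlow l y w
    · have := h₃ h
      simp only [r] at this
      omega
    · omega

end Rounding

/-! ### Edge-disjoint paths from flows -/

section Paths

universe u₁ u₂

lemma IsSimplePath.eq_or_exists_rel {V : Type*} {r : V → V → Prop} {a b x : V} {l : List V}
    (h : IsSimplePath r a b l) (hx : x ∈ l) : x = a ∨ ∃ y, r y x := by
  induction h with
  | nil u => left; simpa using hx
  | @cons a b c l hab hl ha ih =>
    rcases List.mem_cons.1 hx with rfl | hx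
    · exact Or.inl rfl
    · rcases ih hx with rfl | h
      · exact Or.inr ⟨a, hab⟩
      · exact Or.inr h

variable {γ : Type u₁} {δ : Type u₂} {G : Graph γ δ}

/-- A simple path whose steps are realized by edges in `D` yields a walk that uses no more edges
between two vertices than the path has steps there. -/
lemma exists_walk_of_isSimplePath [DecidableEq V(G)] {D : Set δ} {r : V(G) → V(G) → Prop}
    (hr : ∀ x y, r x y → ∃ e ∈ D, G.IsLink e x y) {u v : V(G)} {l : List V(G)}
    (h : IsSimplePath r u v l) :
    ∃ P : G.Walk u v, P.support = l.map Subtype.val ∧ (∀ e ∈ P.edges, e ∈ D) ∧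
      ∀ x y : V(G), {e | e ∈ P.edges ∧ G.IsLink e x y}.ncard ≤ (pathFlow l x y).natAbs := by
  induction h with
  | nil u => exact ⟨.nil u.2, rfl, by simp [Graph.Walk.edges], by simp [Graph.Walk.edges]⟩
  | @cons a b c l hab hl ha ih =>
    obtain ⟨P, h₁, h₂, h₃⟩ := ih
    obtain ⟨e, heD, he⟩ := hr _ _ hab
    refine ⟨.cons e he P, by simp [Graph.Walk.support, h₁], ?_, ?_⟩
    · intro f hf
      rcases List.mem_cons.1 hf with rfl | hf
      exacts [heD, h₂ f hf]
    have hfin : ∀ x y : V(G), {f | f ∈ P.edges ∧ G.IsLink f x y}.Finite :=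
      fun x y => (P.edges.finite_toSet).subset fun f hf => hf.1
    have hne : a ≠ b := fun h => ha (h ▸ hl.left_mem)
    have key : pathFlow (a :: l) = arc a b + pathFlow l := by
      cases hl <;> rfl
    have hP : ∀ x y : V(G), pathFlow l x y = 0 → ∀ f ∈ P.edges, ¬ G.IsLink f x y := by
      intro x y h f hf hl
      have h' := h₃ x y
      rw [h, Int.natAbs_zero, Nat.le_zero, Set.ncard_eq_zero (hfin x y)] at h'
      exact h'.subset ⟨hf, hl⟩
    have hPa : ∀ y : V(G), ∀ f ∈ P.edges, ¬ G.IsLink f a y :=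
      fun y => hP a y (pathFlow_eq_zero_left ha y)
    intro x y
    have hcons : ∀ f, f ∈ (Graph.Walk.cons e he P).edges ↔ f = e ∨ f ∈ P.edges :=
      fun f => List.mem_cons
    have main : ∀ y : V(G), {f | f ∈ (Graph.Walk.cons e he P).edges ∧ G.IsLink f a y}.ncard ≤
        (pathFlow (a :: l) a y).natAbs := by
      intro y
      have hsub : {f | f ∈ (Graph.Walk.cons e he P).edges ∧ G.IsLink f a y} ⊆ {e} := by
        rintro f ⟨hf, hfl⟩
        rcases (hcons f).1 hf with rfl | hf
        · rfl
        · exact absurd hfl (hPa y f hf)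
      by_cases hy : y = b
      · subst hy
        have : pathFlow (a :: l) a y = 1 := by
          simp [key, arc, pathFlow_eq_zero_left ha, hne]
        rw [this]
        exact (Set.ncard_le_ncard hsub).trans (by simp)
      · have : {f | f ∈ (Graph.Walk.cons e he P).edges ∧ G.IsLink f a y} = ∅ := by
          rw [Set.eq_empty_iff_forall_notMem]
          intro f hf
          obtain rfl : f = e := hsub hf
          exact hy (Subtype.ext (hf.2.right_unique he))
        simp [this]
    by_cases hx : x = a
    · subst hx; exact main y
    by_cases hy : y = a
    · subst hy
      rw [isFlow_pathFlow, Int.natAbs_neg]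
      convert main x using 4
      exact and_congr_right fun _ => G.isLink_comm
    have hset : {f | f ∈ (Graph.Walk.cons e he P).edges ∧ G.IsLink f x y} =
        {f | f ∈ P.edges ∧ G.IsLink f x y} := by
      ext f
      simp only [Set.mem_ofPred_eq, hcons]
      constructor
      · rintro ⟨rfl | hf, hl⟩
        · rcases he.left_eq_or_eq hl with h | h
          · exact absurd (Subtype.ext h.symm) hx
          · exact absurd (Subtype.ext h.symm) hy
        · exact ⟨hf, hl⟩
      · rintro ⟨hf, hl⟩; exact ⟨Or.inr hf, hl⟩
    rw [hset, key]
    simpa [arc, hx, hy] using h₃ x y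

/-- An integral flow from sources `σ j` to `v` that respects the numbers of parallel edges
decomposes into edge-disjoint paths; a path enters a vertex only where the flow does. -/
theorem exists_paths_of_integral_flow {ι : Type*} [Fintype V(G)] [DecidableEq V(G)]
    [DecidableEq ι] (σ : ι → V(G)) (v : V(G)) (J : Finset ι) (hσ : ∀ j ∈ J, σ j ≠ v)
    (D : Set δ) (hD : D.Finite) (g : V(G) → V(G) → ℤ) (hg : IsFlow g)
    (hle : ∀ x y, g x y ≤ ({e | e ∈ D ∧ G.IsLink e x y}.ncard : ℤ))
    (hout : ∀ x, outflow g x = ∑ j ∈ J, demand (σ j) v x) :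
    ∃ E : ι → Set δ, (∀ j ∈ J, E j ⊆ D) ∧ (∀ i ∈ J, ∀ j ∈ J, i ≠ j → Disjoint (E i) (E j)) ∧
      ∀ j ∈ J, ∃ P : G.Walk (σ j) v, P.IsPath ∧ (∀ e ∈ P.edges, e ∈ E j) ∧
        ∀ x : V(G), (x : γ) ∈ P.support → x = σ j ∨ ∃ a, 0 < g a x := by
  induction J using Finset.induction_on generalizing D g with
  | empty => exact ⟨fun _ => ∅, by simp, by simp, by simp⟩
  | @insert j J hj ih =>
    let r : V(G) → V(G) → Prop := fun x y => 0 < g x y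
    -- Otherwise no flow leaves the set reachable from `σ j`, which contains sources but not `v`.
    have hreach : Relation.ReflTransGen r (σ j) v := by
      classical
      by_contra hv
      let R : Finset V(G) := Finset.univ.filter fun y => Relation.ReflTransGen r (σ j) y
      have hvR : v ∉ R := by simpa [R] using hv
      have hjR : σ j ∈ R := by simp [R, Relation.ReflTransGen.refl]
      have h₁ := sum_outflow hg R
      have h₂ : ∑ x ∈ R, ∑ y ∈ Rᶜ, g x y ≤ 0 := by
        refine Finset.sum_nonpos fun x hx => Finset.sum_nonpos fun y hy => ?_
        by_contra! h
        apply Finset.mem_compl.1 hy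
        simp only [R, Finset.mem_filter, Finset.mem_univ, true_and] at hx ⊢
        exact hx.tail h
      have h₃ : 0 < ∑ x ∈ R, outflow g x := by
        simp only [hout]
        have hd : ∀ i, ∀ x ∈ R, 0 ≤ demand (σ i) v x := by
          intro i x hx
          have : x ≠ v := by rintro rfl; exact hvR hx
          simp only [demand, this, if_false]
          split_ifs <;> simp
        refine Finset.sum_pos' (fun x hx => Finset.sum_nonneg fun i _ => hd i x hx)
          ⟨σ j, hjR, Finset.sum_pos' (fun i _ => hd i _ hjR)
            ⟨j, Finset.mem_insert_self _ _, ?_⟩⟩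
        simp [demand, hσ j (Finset.mem_insert_self _ _)]
      omega
    obtain ⟨l, hl⟩ := IsSimplePath.exists_of_reflTransGen hreach
    have hr : ∀ x y, r x y → ∃ e ∈ D, G.IsLink e x y := by
      intro x y hxy
      have h₁ := hle x y
      have h₂ : 0 < {e | e ∈ D ∧ G.IsLink e x y}.ncard := by
        simp only [r] at hxy; omega
      obtain ⟨e, he⟩ := Set.nonempty_of_ncard_ne_zero h₂.ne'
      exact ⟨e, he⟩
    obtain ⟨P, hsupp, hPD, hPn⟩ := exists_walk_of_isSimplePath hr hl
    have hspec := fun x y => pathFlow_spec hl x y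
    have hneg := neg_one_le_pathFlow hl
    have hanti : ∀ x y, pathFlow l x y = -1 → g x y ≤ -1 := by
      intro x y h
      have h₁ := isFlow_pathFlow l x y
      have h₂ := (hspec y x).2.1 (by omega)
      have h₃ := hg x y
      simp only [r] at h₂
      omega
    obtain ⟨E, hED, hdisj, hE⟩ := ih (fun i hi => hσ i (Finset.mem_insert_of_mem hi))
      (D \ {e | e ∈ P.edges}) (hD.subset Set.sdiff_subset) (g - pathFlow l)
      (fun x y => by
        have h₁ := hg x y
        have h₂ := isFlow_pathFlow l x y
        simp only [Pi.sub_apply]; omega)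
      (fun x y => by
        have h₁ := hle x y
        have h₂ := hPn x y
        have h₃ : {e | e ∈ D ∧ G.IsLink e x y}.ncard ≤
            {e | e ∈ D \ {e | e ∈ P.edges} ∧ G.IsLink e x y}.ncard +
              {e | e ∈ P.edges ∧ G.IsLink e x y}.ncard := by
          refine (Set.ncard_le_ncard ?_ ?_).trans (Set.ncard_union_le _ _)
          · rintro e ⟨h, h'⟩
            by_cases he : e ∈ P.edges
            · exact Or.inr ⟨he, h'⟩
            · exact Or.inl ⟨⟨h, he⟩, h'⟩
          · exact (hD.subset fun e h => h.1.1).union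
              ((P.edges.finite_toSet).subset fun f hf => hf.1)
        have h₄ := hspec x y
        have h₅ := hneg x y
        have h₆ := hanti x y
        simp only [Pi.sub_apply]
        omega)
      (fun x => by
        have h₁ := hout x
        rw [Finset.sum_insert hj, ← outflow_pathFlow hl] at h₁
        have h₂ := outflow_add (g - pathFlow l) (pathFlow l) x
        rw [sub_add_cancel] at h₂
        omega)
    have hne : ∀ i ∈ J, i ≠ j := by rintro i hi rfl; exact hj hi
    refine ⟨Function.update E j {e | e ∈ P.edges}, ?_, ?_, ?_⟩
    · intro i hi
      rcases Finset.mem_insert.1 hi with rfl | hi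
      · rw [Function.update_self]; exact hPD
      · rw [Function.update_of_ne (hne i hi)]
        exact (hED i hi).trans Set.sdiff_subset
    · have hdj : ∀ i ∈ J, Disjoint (E i) {e | e ∈ P.edges} := fun i hi =>
        Set.disjoint_left.2 fun e he => (hED i hi he).2
      intro i hi k hk hik
      rcases Finset.mem_insert.1 hi with hij | hi' <;> rcases Finset.mem_insert.1 hk with hkj | hk'
      · exact absurd (hij.trans hkj.symm) hik
      · rw [hij, Function.update_self, Function.update_of_ne (hne k hk')]; exact (hdj k hk').symm
      · rw [hkj, Function.update_self, Function.update_of_ne (hne i hi')]; exact hdj i hi'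
      · rw [Function.update_of_ne (hne i hi'), Function.update_of_ne (hne k hk')]
        exact hdisj i hi' k hk' hik
    · intro i hi
      rcases Finset.mem_insert.1 hi with rfl | hi
      · rw [Function.update_self]
        refine ⟨P, ?_, fun e he => he, fun x hx => ?_⟩
        · rw [Graph.Walk.IsPath, hsupp]
          exact hl.nodup.map Subtype.val_injective
        · rw [hsupp, List.mem_map] at hx
          obtain ⟨y, hy, hyx⟩ := hx
          obtain rfl := Subtype.ext hyx
          exact hl.eq_or_exists_rel hy
      · rw [Function.update_of_ne (hne i hi)]
        obtain ⟨Q, h₁, h₂, h₃⟩ := hE i hi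
        refine ⟨Q, h₁, h₂, fun x hx => (h₃ x hx).imp_right ?_⟩
        rintro ⟨a, ha⟩
        refine ⟨a, ?_⟩
        have h₄ := hneg a x
        have h₅ := hanti a x
        simp only [Pi.sub_apply] at ha
        omega

/-- The number of edges of `G` that link `x` and `y`. -/
noncomputable def linkCount (G : Graph γ δ) (x y : V(G)) : ℕ := {e | G.IsLink e x y}.ncard

/-- A real flow of integral value from sources `σ j` to `v` that respects the numbers of parallel
edges can be replaced by edge-disjoint paths, which enter a vertex only where the flow does. -/
theorem exists_paths_of_flow {ι : Type*} [Fintype ι] [Fintype V(G)] [DecidableEq V(G)]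
    (hE : E(G).Finite)
    (σ : ι → V(G)) (v : V(G)) (hσ : ∀ j, σ j ≠ v) (f : V(G) → V(G) → ℝ) (hf : IsFlow f)
    (hle : ∀ x y, f x y ≤ linkCount G x y)
    (hout : ∀ x, outflow f x = ∑ j, (demand (σ j) v x : ℝ)) :
    ∃ P : ∀ j, G.Walk (σ j) v, (∀ j, (P j).IsPath) ∧
      (∀ i j, i ≠ j → List.Disjoint (P i).edges (P j).edges) ∧
      ∀ j, ∀ x : V(G), (x : γ) ∈ (P j).support → x = σ j ∨ ∃ a, 0 < f a x := by
  classical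
  obtain ⟨g, hg, hgle, hgout⟩ := exists_integral_flow f hf (fun x => ∑ j, demand (σ j) v x)
    (by simpa using hout)
  obtain ⟨E, -, hdisj, hP⟩ := exists_paths_of_integral_flow σ v Finset.univ (fun j _ => hσ j)
    E(G) hE g hg (fun x y => (hgle x y).trans (Int.ceil_le.2 (by
      have : {e | e ∈ E(G) ∧ G.IsLink e x y} = {e | G.IsLink e x y} :=
        Set.ext fun e => ⟨fun h => h.2, fun h => ⟨h.edge_mem, h⟩⟩
      rw [this]
      exact_mod_cast hle x y))) hgout
  choose P h₁ h₂ h₃ using fun j => hP j (Finset.mem_univ j)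
  refine ⟨P, h₁, fun i j hij e hi hj => ?_, fun j x hx => (h₃ j x hx).imp_right ?_⟩
  · exact Set.disjoint_left.1 (hdisj i (Finset.mem_univ _) j (Finset.mem_univ _) hij)
      (h₂ i e hi) (h₂ j e hj)
  · rintro ⟨a, ha⟩
    exact ⟨a, Int.ceil_pos.1 (ha.trans_le (hgle a x))⟩

end Paths

/-! ### Splitting off vertices -/

section Splitting

universe u

variable {V : Type u} [Fintype V] [DecidableEq V]

/-- The total weight between `S` and its complement. -/
def cutWeight (w : V → V → ℤ) (S : Finset V) : ℤ := ∑ x ∈ S, ∑ y ∈ Sᶜ, w x y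

/-- `S` contains some, but not all, vertices of `X`. -/
def Separates (X S : Finset V) : Prop := (∃ x ∈ X, x ∈ S) ∧ ∃ x ∈ X, x ∉ S

omit [Fintype V] in
lemma even_sum_sum {w : V → V → ℤ} (hs : ∀ x y, w x y = w y x) (h0 : ∀ x, w x x = 0)
    (S : Finset V) : Even (∑ x ∈ S, ∑ y ∈ S, w x y) := by
  induction S using Finset.induction_on with
  | empty => simp
  | @insert a S ha ih =>
    have : ∑ x ∈ S, w x a = ∑ x ∈ S, w a x := Finset.sum_congr rfl fun x _ => hs x a
    simp only [Finset.sum_insert ha, h0, Finset.sum_add_distrib, this, zero_add]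
    rw [← add_assoc]
    exact (Even.add_self _).add ih

lemma even_cutWeight {w : V → V → ℤ} (hs : ∀ x y, w x y = w y x) (h0 : ∀ x, w x x = 0)
    (he : ∀ x, Even (outflow w x)) (S : Finset V) : Even (cutWeight w S) := by
  have h₁ : ∑ x ∈ S, outflow w x = ∑ x ∈ S, ∑ y ∈ S, w x y + cutWeight w S := by
    rw [cutWeight, ← Finset.sum_add_distrib]
    exact Finset.sum_congr rfl fun x _ => (Finset.sum_add_sum_compl S _).symm
  have h₂ : Even (∑ x ∈ S, outflow w x) := Finset.even_sum _ fun x _ => he x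
  have h₃ := even_sum_sum hs h0 S
  rw [h₁] at h₂
  exact (Int.even_add.1 h₂).1 h₃

lemma cutWeight_compl {w : V → V → ℤ} (hs : ∀ x y, w x y = w y x) (S : Finset V) :
    cutWeight w Sᶜ = cutWeight w S := by
  rw [cutWeight, cutWeight, compl_compl, Finset.sum_comm]
  exact Finset.sum_congr rfl fun x _ => Finset.sum_congr rfl fun y _ => hs y x

lemma Separates.compl {X S : Finset V} (h : Separates X S) : Separates X Sᶜ := by
  obtain ⟨⟨x, hx, hxS⟩, y, hy, hyS⟩ := h
  exact ⟨⟨y, hy, by simpa using hyS⟩, x, hx, by simpa using hxS⟩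

lemma cutWeight_eq_sum (w : V → V → ℤ) (S : Finset V) :
    cutWeight w S = ∑ x, ∑ y, if x ∈ S ∧ y ∉ S then w x y else 0 := by
  simp only [cutWeight, ite_and, Finset.sum_ite_irrel, Finset.sum_const_zero]
  rw [← Finset.sum_filter]
  simp only [Finset.filter_mem_eq_inter, Finset.univ_inter, ← Finset.sum_filter]
  refine Finset.sum_congr rfl fun x _ => Finset.sum_congr ?_ fun _ _ => rfl
  ext; simp

/-- Submodularity of cuts; the weight between `P \ Q` and `Q \ P` is the defect. -/
lemma cutWeight_inter_add_union {w : V → V → ℤ} (hs : ∀ x y, w x y = w y x)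
    (hw : ∀ x y, 0 ≤ w x y) (P Q : Finset V) {a b : V} (ha : a ∈ P) (ha' : a ∉ Q) (hb : b ∈ Q)
    (hb' : b ∉ P) :
    cutWeight w (P ∩ Q) + cutWeight w (P ∪ Q) + 2 * w a b ≤ cutWeight w P + cutWeight w Q := by
  have h₁ : 2 * w a b = ∑ x, ∑ y, ((if x = a ∧ y = b then w x y else 0) +
      (if x = b ∧ y = a then w x y else 0)) := by
    simp [Finset.sum_add_distrib, ite_and, hs b a, two_mul]
  simp only [h₁, cutWeight_eq_sum, ← Finset.sum_add_distrib]
  refine Finset.sum_le_sum fun x _ => Finset.sum_le_sum fun y _ => ?_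
  have h := hw x y
  have hab : a ≠ b := by rintro rfl; exact hb' ha
  by_cases h₁ : x = a ∧ y = b
  · obtain ⟨rfl, rfl⟩ := h₁
    simp [ha, ha', hb, hb', hab, hab.symm]
  by_cases h₂ : x = b ∧ y = a
  · obtain ⟨rfl, rfl⟩ := h₂
    simp [ha, ha', hb, hb', hab, hab.symm]
  simp only [h₁, h₂, if_false, Finset.mem_inter, Finset.mem_union]
  by_cases h₃ : x ∈ P <;> by_cases h₄ : x ∈ Q <;> by_cases h₅ : y ∈ P <;> by_cases h₆ : y ∈ Q <;>
    simp [h₃, h₄, h₅, h₆, h]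

/-- The weight function of a single edge between `a` and `b`; it is `0` if `a = b`. -/
def edgeWeight (a b : V) : V → V → ℤ := fun x y =>
  if a = b then 0 else (if x = a ∧ y = b then 1 else 0) + (if x = b ∧ y = a then 1 else 0)

omit [Fintype V] in
lemma edgeWeight_symm (a b x y : V) : edgeWeight a b x y = edgeWeight a b y x := by
  simp only [edgeWeight, and_comm, add_comm]

omit [Fintype V] in
lemma edgeWeight_self (a b x : V) : edgeWeight a b x x = 0 := by
  simp only [edgeWeight]
  grind

lemma outflow_edgeWeight (a b x : V) : outflow (edgeWeight a b) x =
    if a = b then 0 else (if x = a then 1 else 0) + (if x = b then 1 else 0) := by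
  by_cases h : a = b
  · simp [outflow, edgeWeight, h]
  · simp only [outflow, edgeWeight, h, if_false, Finset.sum_add_distrib, ite_and]
    split_ifs <;> simp

lemma cutWeight_edgeWeight (a b : V) (S : Finset V) :
    cutWeight (edgeWeight a b) S = if (a ∈ S ↔ b ∈ S) then 0 else 1 := by
  by_cases h : a = b
  · simp [cutWeight, edgeWeight, h]
  · have : ∀ x y, (if x ∈ S ∧ y ∉ S then edgeWeight a b x y else 0) =
      (if x = a ∧ y = b then (if a ∈ S ∧ b ∉ S then (1 : ℤ) else 0) else 0) +
      (if x = b ∧ y = a then (if b ∈ S ∧ a ∉ S then (1 : ℤ) else 0) else 0) := by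
      intro x y
      simp only [edgeWeight, h, if_false]
      by_cases h₁ : x = a ∧ y = b
      · obtain ⟨rfl, rfl⟩ := h₁
        simp [h]
      by_cases h₂ : x = b ∧ y = a
      · obtain ⟨rfl, rfl⟩ := h₂
        simp [Ne.symm h]
      simp [h₁, h₂]
    rw [cutWeight_eq_sum]
    simp only [this, Finset.sum_add_distrib, ite_and, Finset.sum_ite_irrel,
      Finset.sum_const_zero, Finset.sum_ite_eq', Finset.mem_univ, if_true]
    by_cases ha : a ∈ S <;> by_cases hb : b ∈ S <;> simp [ha, hb]

/-- Splitting off a pair of edges from `s` to `u` and `v`. -/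
def splitOff (w : V → V → ℤ) (s u v : V) : V → V → ℤ :=
  w - edgeWeight s u - edgeWeight s v + edgeWeight u v

lemma cutWeight_splitOff (w : V → V → ℤ) (s u v : V) (S : Finset V) :
    cutWeight (splitOff w s u v) S = cutWeight w S - cutWeight (edgeWeight s u) S -
      cutWeight (edgeWeight s v) S + cutWeight (edgeWeight u v) S := by
  simp only [cutWeight, splitOff, Pi.add_apply, Pi.sub_apply, Finset.sum_add_distrib,
    Finset.sum_sub_distrib]

lemma outflow_splitOff (w : V → V → ℤ) (s u v x : V) :
    outflow (splitOff w s u v) x = outflow w x - outflow (edgeWeight s u) x -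
      outflow (edgeWeight s v) x + outflow (edgeWeight u v) x := by
  simp only [outflow, splitOff, Pi.add_apply, Pi.sub_apply, Finset.sum_add_distrib,
    Finset.sum_sub_distrib]

/-- Every flow bounded by `w` has a counterpart bounded by `μ` with the same outflows that does not
use the vertices of `X` more than the given flow does. -/
def Lifts (μ : V → V → ℤ) (X : Finset V) (w : V → V → ℤ) : Prop :=
  ∀ ψ : V → V → ℝ, IsFlow ψ → (∀ x y, ψ x y ≤ w x y) →
    ∃ φ : V → V → ℝ, IsFlow φ ∧ (∀ x y, φ x y ≤ μ x y) ∧ (∀ x, outflow φ x = outflow ψ x) ∧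
      ∀ x ∈ X, ∑ y, |φ x y| ≤ ∑ y, |ψ x y|

/-- A flow that uses a split-off edge can be rerouted along the original pair of edges. The flow
moved is the fair share `ψ u v / splitOff w s u v u v` of one of the parallel edges. -/
lemma Lifts.splitOff {μ w : V → V → ℤ} {X : Finset V} (h : Lifts μ X w)
    (hs : ∀ x y, w x y = w y x) (hw : ∀ x y, 0 ≤ w x y) {s u v : V} (hsX : s ∉ X) (hsu : s ≠ u)
    (hsv : s ≠ v) : Lifts μ X (splitOff w s u v) := by
  intro ψ hψ hle
  by_cases huv : u = v
  · subst huv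
    refine h ψ hψ fun x y => (hle x y).trans ?_
    have : StrongImmersion.splitOff w s u u x y ≤ w x y := by
      simp only [StrongImmersion.splitOff, Pi.add_apply, Pi.sub_apply, edgeWeight, hsu, if_false,
        if_true]
      split_ifs <;> omega
    exact_mod_cast this
  have hq := hw u v
  have hval : StrongImmersion.splitOff w s u v u v = w u v + 1 := by
    simp [StrongImmersion.splitOff, edgeWeight, hsu, hsv, huv, hsu.symm, hsv.symm]
  obtain ⟨q, hqdef⟩ : ∃ q : ℝ, q = w u v + 1 := ⟨_, rfl⟩
  have hq1 : 1 ≤ q := by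
    have : (0 : ℝ) ≤ w u v := by exact_mod_cast hq
    linarith
  obtain ⟨θ, hθ⟩ : ∃ θ : ℝ, θ = ψ u v / q := ⟨_, rfl⟩
  have hψq : ψ u v = q * θ := by rw [hθ]; field_simp
  have hup : ψ u v ≤ q := by
    have := hle u v
    rw [hval] at this
    push_cast at this
    linarith
  have hlo : - q ≤ ψ u v := by
    have h₁ := hle v u
    rw [show StrongImmersion.splitOff w s u v v u = w u v + 1 by
      simp [StrongImmersion.splitOff, edgeWeight, hsu, hsv, huv, hsu.symm, hsv.symm, hs v u,
        Ne.symm huv], hψ v u] at h₁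
    push_cast at h₁
    linarith
  have hθ1 : θ ≤ 1 := by nlinarith
  have hθ2 : -1 ≤ θ := by nlinarith
  let ψ' : V → V → ℝ := fun x y => ψ x y + θ * (arc u s x y + arc s v x y - arc u v x y : ℤ)
  have hval' : ∀ x y, (x, y) ≠ (u, s) → (x, y) ≠ (s, u) → (x, y) ≠ (s, v) → (x, y) ≠ (v, s) →
      (x, y) ≠ (u, v) → (x, y) ≠ (v, u) →
      ψ' x y = ψ x y ∧ StrongImmersion.splitOff w s u v x y = w x y := by
    intro x y h₁ h₂ h₃ h₄ h₅ h₆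
    simp only [ne_eq, Prod.mk.injEq] at h₁ h₂ h₃ h₄ h₅ h₆
    simp [ψ', arc, StrongImmersion.splitOff, edgeWeight, h₁, h₂, h₃, h₄, h₅, h₆]
  have hflow : IsFlow ψ' := by
    intro x y
    simp only [ψ', arc]
    rw [hψ x y]
    push_cast
    simp only [and_comm]
    ring
  have us : ψ' u s = ψ u s + θ := by simp [ψ', arc, hsu, hsv, huv, hsu.symm]
  have sv : ψ' s v = ψ s v + θ := by simp [ψ', arc, hsu, hsv, Ne.symm huv, hsv.symm]
  have uv : ψ' u v = ψ u v - θ := by simp [ψ', arc, huv, hsu.symm, hsv.symm]; ring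
  have wus : w u s = StrongImmersion.splitOff w s u v u s + 1 := by
    simp [StrongImmersion.splitOff, edgeWeight, hsu, hsv, huv, hsu.symm]
  have wsv : w s v = StrongImmersion.splitOff w s u v s v + 1 := by
    simp [StrongImmersion.splitOff, edgeWeight, hsu, hsv, Ne.symm huv, huv, hsv.symm]
  have wsymm : ∀ x y, StrongImmersion.splitOff w s u v x y =
      StrongImmersion.splitOff w s u v y x := by
    intro x y
    simp only [StrongImmersion.splitOff, Pi.add_apply, Pi.sub_apply, hs x y,
      edgeWeight_symm _ _ x y]
  obtain ⟨φ, h₁, h₂, h₃, h₄⟩ := h ψ' hflow (fun x y => by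
    by_cases c₁ : (x, y) = (u, s)
    · obtain ⟨rfl, rfl⟩ := Prod.mk.inj c₁
      have := hle x y
      rw [us, wus]; push_cast; linarith
    by_cases c₂ : (x, y) = (s, u)
    · obtain ⟨rfl, rfl⟩ := Prod.mk.inj c₂
      have := hle x y
      rw [hflow, us, hs, wus, wsymm]; push_cast; rw [hψ] at this; linarith
    by_cases c₃ : (x, y) = (s, v)
    · obtain ⟨rfl, rfl⟩ := Prod.mk.inj c₃
      have := hle x y
      rw [sv, wsv]; push_cast; linarith
    by_cases c₄ : (x, y) = (v, s)
    · obtain ⟨rfl, rfl⟩ := Prod.mk.inj c₄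
      have := hle x y
      rw [hflow, sv, hs, wsv, wsymm]; push_cast; rw [hψ] at this; linarith
    by_cases c₅ : (x, y) = (u, v)
    · obtain ⟨rfl, rfl⟩ := Prod.mk.inj c₅
      rw [uv, hψq]; nlinarith
    by_cases c₆ : (x, y) = (v, u)
    · obtain ⟨rfl, rfl⟩ := Prod.mk.inj c₆
      rw [hflow, uv, hs, hψq]; nlinarith
    obtain ⟨e₁, e₂⟩ := hval' x y c₁ c₂ c₃ c₄ c₅ c₆
    rw [e₁, ← e₂]; exact hle x y)
  refine ⟨φ, h₁, h₂, fun x => (h₃ x).trans ?_, fun x hx => (h₄ x hx).trans ?_⟩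
  · have h₅ : outflow ψ' x = outflow ψ x + θ * ((outflow (arc u s) x + outflow (arc s v) x -
        outflow (arc u v) x : ℤ) : ℝ) := by
      simp only [outflow, ψ', Finset.sum_add_distrib, ← Finset.mul_sum]
      push_cast
      simp only [Finset.sum_add_distrib, Finset.sum_sub_distrib]
    rw [h₅]
    simp only [outflow_arc, demand]
    push_cast
    ring
  · have hxs : x ≠ s := by rintro rfl; exact hsX hx
    have hθabs : |ψ u v - θ| = |ψ u v| - |θ| := by
      rw [hψq, abs_mul, abs_of_nonneg (by linarith : (0 : ℝ) ≤ q),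
        show q * θ - θ = (q - 1) * θ by ring, abs_mul, abs_of_nonneg (by linarith : 0 ≤ q - 1)]
      ring
    -- Moving flow from the edge `uv` to an edge at `s` does not increase the use of `u` and `v`.
    have step : ∀ a : V, ∀ t : V, (∀ y, |ψ' a y| ≤ |ψ a y| + (if y = s then |θ| else 0) -
        (if y = t then |θ| else 0)) → ∑ y, |ψ' a y| ≤ ∑ y, |ψ a y| := by
      intro a t h
      refine (Finset.sum_le_sum fun y _ => h y).trans ?_
      simp [Finset.sum_add_distrib, Finset.sum_sub_distrib]
    by_cases hxu : x = u
    · subst hxu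
      refine step x v fun y => ?_
      by_cases c₁ : y = s
      · subst c₁
        rw [us]; simpa [hsv] using abs_add_le _ _
      by_cases c₂ : y = v
      · subst c₂
        rw [uv, hθabs]; simp [hsv.symm]
      rw [(hval' x y (by simp [c₁]) (by simp [hxs]) (by simp [hxs]) (by simp [huv])
        (by simp [c₂]) (by simp [huv])).1]
      simp [c₁, c₂]
    by_cases hxv : x = v
    · subst hxv
      refine step x u fun y => ?_
      by_cases c₁ : y = s
      · subst c₁
        rw [hflow, sv, hψ x y, abs_neg, abs_neg]; simpa [hsu] using abs_add_le _ _
      by_cases c₂ : y = u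
      · subst c₂
        rw [hflow, uv, hψ x y, abs_neg, abs_neg, hθabs]; simp [hsu.symm]
      rw [(hval' x y (by simp [hxu]) (by simp [hxs]) (by simp [hxs]) (by simp [c₁])
        (by simp [hxu]) (by simp [c₂])).1]
      simp [c₁, c₂]
    refine (Finset.sum_congr rfl fun y _ => ?_).le
    rw [(hval' x y (by simp [hxu]) (by simp [hxs]) (by simp [hxs]) (by simp [hxv])
        (by simp [hxu]) (by simp [hxv])).1]

/-- An even weight function with large `X`-cuts whose flows lift to `μ`. -/
structure IsReduction (μ : V → V → ℤ) (X : Finset V) (k : ℤ) (w : V → V → ℤ) : Prop where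
  symm : ∀ x y, w x y = w y x
  nonneg : ∀ x y, 0 ≤ w x y
  diag : ∀ x, w x x = 0
  even : ∀ x, Even (outflow w x)
  cut : ∀ S, Separates X S → k ≤ cutWeight w S
  lifts : Lifts μ X w

/-- The tight sets that contain `u` but not `s`, which obstruct splitting off the edge from `s` to
`u`, are closed under union. -/
lemma IsReduction.union_tight {μ w : V → V → ℤ} {X : Finset V} {k : ℤ} (h : IsReduction μ X k w)
    {s u : V} (hsu : 0 < w s u) {S T : Finset V}
    (hS : Separates X S ∧ u ∈ S ∧ s ∉ S ∧ cutWeight w S = k)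
    (hT : Separates X T ∧ u ∈ T ∧ s ∉ T ∧ cutWeight w T = k) :
    Separates X (S ∪ T) ∧ u ∈ S ∪ T ∧ s ∉ S ∪ T ∧ cutWeight w (S ∪ T) = k := by
  obtain ⟨⟨⟨a, ha, haS⟩, b, hb, hbS⟩, huS, hsS, hSk⟩ := hS
  obtain ⟨⟨⟨c, hc, hcT⟩, d, hd, hdT⟩, huT, hsT, hTk⟩ := hT
  -- Either `S ∩ T` and `S ∪ T` both separate `X`, or `S \ T` and `T \ S` both do. The latter is
  -- impossible, since the edge from `s` to `u` is then counted in the defect of submodularity.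
  by_cases hcase : (∃ x ∈ X, x ∈ S ∩ T) ∧ ∃ x ∈ X, x ∉ S ∪ T
  · obtain ⟨hi, hu⟩ := hcase
    have h₁ : Separates X (S ∩ T) := ⟨hi, b, hb, fun h => hbS (Finset.mem_inter.1 h).1⟩
    have h₂ : Separates X (S ∪ T) := ⟨⟨a, ha, Finset.mem_union_left _ haS⟩, hu⟩
    refine ⟨h₂, Finset.mem_union_left _ huS, by simp [hsS, hsT], ?_⟩
    have h₃ := h.cut _ h₁
    have h₄ := h.cut _ h₂
    by_cases hST : ∃ x ∈ S, x ∉ T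
    · obtain ⟨x, hxS, hxT⟩ := hST
      by_cases hTS : ∃ y ∈ T, y ∉ S
      · obtain ⟨y, hyT, hyS⟩ := hTS
        have h₅ := cutWeight_inter_add_union h.symm h.nonneg S T hxS hxT hyT hyS
        have h₆ := h.nonneg x y
        omega
      · push Not at hTS
        rw [Finset.union_eq_left.2 hTS, hSk]
    · push Not at hST
      rw [Finset.union_eq_right.2 hST, hTk]
  · exfalso
    have h₁ : Separates X (S ∩ Tᶜ) := by
      refine ⟨?_, b, hb, fun h => hbS (Finset.mem_inter.1 h).1⟩
      by_cases haT : a ∈ T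
      · refine ⟨d, hd, Finset.mem_inter.2 ⟨?_, Finset.mem_compl.2 hdT⟩⟩
        by_contra hdS
        exact hcase ⟨⟨a, ha, Finset.mem_inter.2 ⟨haS, haT⟩⟩, d, hd, by simp [hdS, hdT]⟩
      · exact ⟨a, ha, by simp [haS, haT]⟩
    have h₂ : Separates X (S ∪ Tᶜ) := by
      refine ⟨⟨a, ha, Finset.mem_union_left _ haS⟩, ?_⟩
      by_cases hcS : c ∈ S
      · refine ⟨b, hb, ?_⟩
        have : b ∈ T := by
          by_contra hbT
          exact hcase ⟨⟨c, hc, Finset.mem_inter.2 ⟨hcS, hcT⟩⟩, b, hb, by simp [hbS, hbT]⟩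
        simp [hbS, this]
      · exact ⟨c, hc, by simp [hcS, hcT]⟩
    have h₃ := cutWeight_inter_add_union h.symm h.nonneg S Tᶜ huS (by simpa using huT)
      (by simpa using hsT) hsS
    rw [cutWeight_compl h.symm, h.symm u s] at h₃
    have h₄ := h.cut _ h₁
    have h₅ := h.cut _ h₂
    omega

/-- Lovász's splitting argument: an edge from `s` to `u` can be split off together with an edge
to a neighbour of `s` outside the largest tight set. -/
lemma IsReduction.exists_splitOff {μ w : V → V → ℤ} {X : Finset V} {k : ℤ} (hk : Even k)
    (h : IsReduction μ X k w) {s : V} (hsX : s ∉ X) (hs : outflow w s ≠ 0) :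
    ∃ u v, s ≠ u ∧ s ≠ v ∧ IsReduction μ X k (splitOff w s u v) := by
  classical
  obtain ⟨u, hu⟩ : ∃ u, 0 < w s u := by
    by_contra! hall
    exact hs (Finset.sum_eq_zero fun u _ => le_antisymm (hall u) (h.nonneg s u))
  have hsu : s ≠ u := by
    rintro rfl
    rw [h.diag] at hu
    exact lt_irrefl _ hu
  let 𝒯 : Finset (Finset V) := Finset.univ.filter fun S =>
    Separates X S ∧ u ∈ S ∧ s ∉ S ∧ cutWeight w S = k
  obtain ⟨v, hv, hvu, hvT⟩ : ∃ v, 0 < w s v ∧ (v = u → 2 ≤ w s u) ∧ ∀ S ∈ 𝒯, v ∉ S := by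
    by_cases hne : 𝒯.Nonempty
    · have hA : 𝒯.sup id ∈ 𝒯 := by
        have hcl : SupClosed (𝒯 : Set (Finset V)) := by
          intro S hS T hT
          simp only [𝒯, Finset.coe_filter, Finset.mem_univ, true_and, Set.mem_ofPred_eq,
            Finset.sup_eq_union] at hS hT ⊢
          exact h.union_tight hu hS hT
        exact hcl.finsetSup_mem hne fun S hS => hS
      obtain ⟨hsep, huA, hsA, hAk⟩ := (Finset.mem_filter.1 hA).2
      obtain ⟨A, hAdef⟩ : ∃ A, A = 𝒯.sup id := ⟨_, rfl⟩
      rw [← hAdef] at hsep huA hsA hAk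
      by_contra! hcon
      have hall : ∀ v, v ∉ A → w s v = 0 := by
        intro v hvA
        by_contra hv0
        have hv : 0 < w s v := lt_of_le_of_ne (h.nonneg s v) (Ne.symm hv0)
        obtain ⟨S, hS, hvS⟩ := hcon v hv (fun hvu => absurd huA (hvu ▸ hvA))
        exact hvA (hAdef ▸ Finset.le_sup (f := id) hS hvS)
      -- If all neighbours of `s` were in the largest tight set `A`, moving `s` into `A` would give
      -- a cut that is too small.
      have h₁ : cutWeight w (insert s A) + ∑ x ∈ A, w x s = cutWeight w A := by
        have h₂ : Aᶜ = insert s (insert s A)ᶜ := by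
          ext x
          by_cases hx : x = s
          · simp [hx, hsA]
          · simp [hx]
        rw [cutWeight, cutWeight, Finset.sum_insert hsA, Finset.sum_eq_zero fun y hy =>
          hall y (by simp only [Finset.mem_compl, Finset.mem_insert, not_or] at hy; exact hy.2),
          zero_add, ← Finset.sum_add_distrib]
        refine Finset.sum_congr rfl fun x _ => ?_
        rw [h₂, Finset.sum_insert (by simp), add_comm]
      have h₂ : 0 < ∑ x ∈ A, w x s :=
        Finset.sum_pos' (fun x _ => h.nonneg x s) ⟨u, huA, by rw [h.symm]; exact hu⟩
      have h₃ : Separates X (insert s A) := by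
        obtain ⟨⟨a, ha, haA⟩, b, hb, hbA⟩ := hsep
        refine ⟨⟨a, ha, Finset.mem_insert_of_mem haA⟩, b, hb, ?_⟩
        rw [Finset.mem_insert, not_or]
        exact ⟨by rintro rfl; exact hsX hb, hbA⟩
      have h₄ := h.cut _ h₃
      omega
    · rw [Finset.not_nonempty_iff_eq_empty] at hne
      simp only [hne, Finset.notMem_empty, false_imp_iff, implies_true, and_true]
      by_cases h2 : 2 ≤ w s u
      · exact ⟨u, hu, fun _ => h2⟩
      · obtain ⟨v, hvu, hv⟩ : ∃ v, v ≠ u ∧ w s v ≠ 0 := by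
          by_contra! hall
          have h₁ : outflow w s = w s u :=
            Finset.sum_eq_single u (fun v _ hvu => hall v hvu) (by simp)
          have h₂ := h.even s
          rw [h₁, show w s u = 1 by omega] at h₂
          exact absurd h₂ (by decide)
        exact ⟨v, lt_of_le_of_ne (h.nonneg s v) (Ne.symm hv), fun e => absurd e hvu⟩
  have hsv : s ≠ v := by
    rintro rfl
    rw [h.diag] at hv
    exact lt_irrefl _ hv
  have hsymm : ∀ x y, splitOff w s u v x y = splitOff w s u v y x := by
    intro x y
    simp only [splitOff, Pi.add_apply, Pi.sub_apply, h.symm x y, edgeWeight_symm _ _ x y]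
  refine ⟨u, v, hsu, hsv, hsymm, ?_, ?_, ?_, ?_, h.lifts.splitOff h.symm h.nonneg hsX hsu hsv⟩
  · have half : ∀ y, 0 ≤ splitOff w s u v s y := by
      intro y
      have h₁ := h.nonneg s y
      simp only [splitOff, Pi.add_apply, Pi.sub_apply, edgeWeight, hsu, hsv, if_false, true_and,
        false_and, add_zero, ite_self]
      by_cases c₁ : y = u
      · subst c₁
        by_cases c₂ : v = y
        · have := hvu c₂
          simp [c₂]; omega
        · simp [Ne.symm c₂]; omega
      · by_cases c₂ : y = v
        · subst c₂
          simp [c₁]; omega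
        · simp [c₁, c₂, h₁]
    intro x y
    by_cases hx : x = s
    · subst hx; exact half y
    by_cases hy : y = s
    · subst hy; rw [hsymm]; exact half x
    have h₁ := h.nonneg x y
    simp only [splitOff, Pi.add_apply, Pi.sub_apply, edgeWeight, hx, hy, false_and, and_false,
      if_false]
    split_ifs <;> simp <;> omega
  · intro x
    simp [splitOff, edgeWeight_self, h.diag]
  · intro x
    rw [outflow_splitOff]
    have h₁ := h.even x
    simp only [outflow_edgeWeight, hsu, hsv, if_false]
    rw [Int.even_iff] at h₁ ⊢
    by_cases c : u = v
    · subst c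
      split_ifs <;> simp <;> omega
    · simp only [c, if_false]
      split_ifs <;> simp_all
      omega
  · have main : ∀ S, Separates X S → s ∉ S → k ≤ cutWeight (splitOff w s u v) S := by
      intro S hS hsS
      have h₁ := h.cut S hS
      have h₂ := even_cutWeight h.symm h.diag h.even S
      rw [cutWeight_splitOff]
      simp only [cutWeight_edgeWeight, hsS, false_iff]
      by_cases huS : u ∈ S <;> by_cases hvS : v ∈ S <;> simp [huS, hvS]
      -- A cut that loses `2` is not tight, so by parity it exceeds `k` by at least `2`.
      · have h₃ : cutWeight w S ≠ k := fun h₃ =>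
          hvT S (Finset.mem_filter.2 ⟨Finset.mem_univ _, hS, huS, hsS, h₃⟩) hvS
        rw [Int.even_iff] at h₂ hk
        omega
      all_goals omega
    intro S hS
    by_cases hsS : s ∈ S
    · rw [← cutWeight_compl hsymm]
      exact main _ hS.compl (by simpa using hsS)
    · exact main S hS hsS

/-- All vertices outside `X` can be split off completely. -/
theorem IsReduction.exists_supported {μ w : V → V → ℤ} {X : Finset V} {k : ℤ} (hk : Even k)
    (h : IsReduction μ X k w) :
    ∃ w', IsReduction μ X k w' ∧ ∀ x y, x ∉ X → w' x y = 0 := by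
  obtain ⟨n, hn⟩ : ∃ n : ℕ, (∑ x ∈ Xᶜ, outflow w x).toNat = n := ⟨_, rfl⟩
  induction n using Nat.strong_induction_on generalizing w with
  | _ n ih =>
    by_cases hz : ∀ x ∉ X, outflow w x = 0
    · refine ⟨w, h, fun x y hx => ?_⟩
      exact (Finset.sum_eq_zero_iff_of_nonneg fun y _ => h.nonneg x y).1 (hz x hx) y
        (Finset.mem_univ _)
    · push Not at hz
      obtain ⟨s, hsX, hs⟩ := hz
      obtain ⟨u, v, hsu, hsv, h'⟩ := h.exists_splitOff hk hsX hs
      refine ih _ ?_ h' rfl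
      have hlt : ∑ x ∈ Xᶜ, outflow (splitOff w s u v) x < ∑ x ∈ Xᶜ, outflow w x := by
        refine Finset.sum_lt_sum (fun x _ => ?_) ⟨s, by simpa using hsX, ?_⟩
        · simp only [outflow_splitOff, outflow_edgeWeight, hsu, hsv, if_false]
          split_ifs <;> omega
        · simp [outflow_splitOff, outflow_edgeWeight, hsu, hsv]
      have h0 : 0 ≤ ∑ x ∈ Xᶜ, outflow (splitOff w s u v) x :=
        Finset.sum_nonneg fun x _ => Finset.sum_nonneg fun y _ => h'.nonneg x y
      omega

end Splitting

/-! ### Connected sets -/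

section Connected

universe u

variable {V : Type u}

/-- The restriction of the relation `r` to `S`. -/
def Inside (r : V → V → Prop) (S : Finset V) (x y : V) : Prop := x ∈ S ∧ y ∈ S ∧ r x y

/-- Any two elements of `S` are joined by a sequence of steps of `r` inside `S`. In particular, the
empty set is connected. -/
def ConnectedIn (r : V → V → Prop) (S : Finset V) : Prop :=
  ∀ x ∈ S, ∀ y ∈ S, Relation.ReflTransGen (Inside r S) x y

variable {r : V → V → Prop}

lemma Inside.mono {S T : Finset V} (h : S ⊆ T) {x y : V} (hxy : Inside r S x y) :
    Inside r T x y := ⟨h hxy.1, h hxy.2.1, hxy.2.2⟩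

lemma reflTransGen_inside_mono {S T : Finset V} (h : S ⊆ T) {x y : V}
    (hxy : Relation.ReflTransGen (Inside r S) x y) : Relation.ReflTransGen (Inside r T) x y :=
  Relation.ReflTransGen.mono (fun _ _ h' => Inside.mono h h') _ _ hxy

lemma reflTransGen_inside_symm (hr : ∀ x y, r x y → r y x) {S : Finset V} {x y : V}
    (h : Relation.ReflTransGen (Inside r S) x y) : Relation.ReflTransGen (Inside r S) y x := by
  induction h with
  | refl => exact .refl
  | tail _ h ih => exact .head ⟨h.2.1, h.1, hr _ _ h.2.2⟩ ih

lemma connectedIn_of_hub (hr : ∀ x y, r x y → r y x) {S : Finset V} (a : V)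
    (h : ∀ x ∈ S, Relation.ReflTransGen (Inside r S) x a) : ConnectedIn r S :=
  fun x hx y hy => (h x hx).trans (reflTransGen_inside_symm hr (h y hy))

lemma exists_crossing {s : V → V → Prop} {S : V → Prop} {x y : V}
    (h : Relation.ReflTransGen s x y) (hx : S x) (hy : ¬ S y) : ∃ a b, S a ∧ ¬ S b ∧ s a b := by
  induction h with
  | refl => exact absurd hx hy
  | @tail b c _ hbc ih =>
    by_cases hb : S b
    · exact ⟨b, c, hb, hy, hbc⟩
    · exact ih hb

variable [DecidableEq V]

/-- From a connected set one can cut off a connected piece with at least `q`, but not many more,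
elements of `P`, so that the rest remains connected. A minimal piece with at least `q` elements of
`P` works: it is attached to the rest at an element `a`, and each of the boundedly many components
of the piece without `a` has fewer than `q` elements of `P`. -/
lemma ConnectedIn.exists_piece [Fintype V] (hr : ∀ x y, r x y → r y x) {d q : ℕ}
    (hd : ∀ x : V, ∀ D : Finset V, (∀ y ∈ D, r y x) → D.card ≤ d) (hq : 0 < q) {S P : Finset V}
    (hS : ConnectedIn r S) (hP : q ≤ (S ∩ P).card) :
    ∃ A ⊆ S, ConnectedIn r A ∧ ConnectedIn r (S \ A) ∧ q ≤ (A ∩ P).card ∧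
      (A ∩ P).card ≤ d * q + 1 := by
  classical
  obtain ⟨A, hA, hmin⟩ := Finset.exists_min_image
    (S.powerset.filter fun A => ConnectedIn r A ∧ ConnectedIn r (S \ A) ∧ q ≤ (A ∩ P).card)
    Finset.card ⟨S, by
      simp only [Finset.mem_filter, Finset.mem_powerset, Finset.Subset.refl, true_and]
      exact ⟨hS, by simp [ConnectedIn], hP⟩⟩
  simp only [Finset.mem_filter, Finset.mem_powerset] at hA hmin
  obtain ⟨hAS, hAc, hAc', hAq⟩ := hA
  refine ⟨A, hAS, hAc, hAc', hAq, ?_⟩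
  obtain ⟨a₀, ha₀⟩ : A.Nonempty := by
    rw [Finset.nonempty_iff_ne_empty]
    rintro rfl
    simp at hAq; omega
  obtain ⟨a, ha, hattach⟩ : ∃ a ∈ A, ∀ x ∈ S \ A,
      Relation.ReflTransGen (Inside r (insert a (S \ A))) x a := by
    by_cases hne : (S \ A).Nonempty
    · obtain ⟨b₀, hb₀⟩ := hne
      obtain ⟨b, a, hb, ha, hab⟩ := exists_crossing (S := fun x => x ∉ A)
        (hS b₀ (Finset.mem_sdiff.1 hb₀).1 a₀ (hAS ha₀)) (Finset.mem_sdiff.1 hb₀).2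
        (not_not.2 ha₀)
      refine ⟨a, not_not.1 ha, fun x hx => ?_⟩
      have hbS : b ∈ S \ A := Finset.mem_sdiff.2 ⟨hab.1, hb⟩
      exact (reflTransGen_inside_mono (Finset.subset_insert _ _) (hAc' x hx b hbS)).tail
        ⟨Finset.mem_insert_of_mem hbS, Finset.mem_insert_self _ _, hab.2.2⟩
    · rw [Finset.not_nonempty_iff_eq_empty] at hne
      exact ⟨a₀, ha₀, by simp [hne]⟩
  -- the component of `n` in the piece without `a`
  let C : V → Finset V := fun n =>
    (A.erase a).filter fun x => Relation.ReflTransGen (Inside r (A.erase a)) n x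
  have hCstep : ∀ n x y, y ∈ C n → x ∈ A.erase a → r x y → x ∈ C n := by
    intro n x y hy hx hxy
    simp only [C, Finset.mem_filter] at hy ⊢
    exact ⟨hx, hy.2.tail ⟨hy.1, hx, hr _ _ hxy⟩⟩
  have hsmall : ∀ n, (C n ∩ P).card ≤ q := by
    intro n
    by_contra! hlt
    have hCA : C n ⊆ A.erase a := Finset.filter_subset _ _
    have hCS : C n ⊆ S := (hCA.trans (Finset.erase_subset _ _)).trans hAS
    have haC : a ∉ C n := fun h => by simpa using hCA h
    have h₁ : ConnectedIn r (C n) := by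
      refine connectedIn_of_hub hr n fun x hx => reflTransGen_inside_symm hr ?_
      have hx' := (Finset.mem_filter.1 hx).2
      clear hx
      induction hx' with
      | refl => exact .refl
      | @tail y z hny hyz ih =>
        exact ih.tail ⟨Finset.mem_filter.2 ⟨hyz.1, hny⟩,
          Finset.mem_filter.2 ⟨hyz.2.1, hny.tail hyz⟩, hyz.2.2⟩
    have h₂ : ConnectedIn r (S \ C n) := by
      refine connectedIn_of_hub hr a fun x hx => ?_
      obtain ⟨hxS, hxC⟩ := Finset.mem_sdiff.1 hx
      by_cases hxA : x ∈ A
      · have hxa := hAc x hxA a ha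
        clear hx hxS hxA
        induction hxa using Relation.ReflTransGen.head_induction_on with
        | refl => exact .refl
        | @head x y hxy _ ih =>
          by_cases hxa : x = a
          · rw [hxa]
          have hyC : y ∉ C n := fun hy =>
            hxC (hCstep n x y hy (Finset.mem_erase.2 ⟨hxa, hxy.1⟩) hxy.2.2)
          exact (ih hyC).head ⟨Finset.mem_sdiff.2 ⟨hAS hxy.1, hxC⟩,
            Finset.mem_sdiff.2 ⟨hAS hxy.2.1, hyC⟩, hxy.2.2⟩
      · refine reflTransGen_inside_mono ?_ (hattach x (Finset.mem_sdiff.2 ⟨hxS, hxA⟩))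
        intro y hy
        rcases Finset.mem_insert.1 hy with rfl | hy
        · exact Finset.mem_sdiff.2 ⟨hAS ha, haC⟩
        · obtain ⟨h, h'⟩ := Finset.mem_sdiff.1 hy
          exact Finset.mem_sdiff.2 ⟨h, fun hyC => h' (Finset.mem_of_mem_erase (hCA hyC))⟩
    have h₃ := hmin (C n) ⟨hCS, h₁, h₂, hlt.le⟩
    have h₄ := Finset.card_le_card hCA
    have h₅ := Finset.card_erase_lt_of_mem ha
    omega
  have hcover : ∀ x ∈ A.erase a, ∃ n ∈ (A.erase a).filter fun n => r n a, x ∈ C n := by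
    intro x hx
    obtain ⟨hxa, hxA⟩ := Finset.mem_erase.1 hx
    have hpath := hAc x hxA a ha
    clear hx hxA
    induction hpath using Relation.ReflTransGen.head_induction_on with
    | refl => exact absurd rfl hxa
    | @head x y hxy _ ih =>
      have hx : x ∈ A.erase a := Finset.mem_erase.2 ⟨hxa, hxy.1⟩
      by_cases hya : y = a
      · subst hya
        exact ⟨x, Finset.mem_filter.2 ⟨hx, hxy.2.2⟩, Finset.mem_filter.2 ⟨hx, .refl⟩⟩
      · obtain ⟨n, hn, hy⟩ := ih hya
        exact ⟨n, hn, hCstep n x y hy hx hxy.2.2⟩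
  have hsub : A ∩ P ⊆ {a} ∪ ((A.erase a).filter fun n => r n a).biUnion fun n => C n ∩ P := by
    intro x hx
    obtain ⟨hxA, hxP⟩ := Finset.mem_inter.1 hx
    by_cases hxa : x = a
    · simp [hxa]
    · obtain ⟨n, hn, hxn⟩ := hcover x (Finset.mem_erase.2 ⟨hxa, hxA⟩)
      exact Finset.mem_union_right _
        (Finset.mem_biUnion.2 ⟨n, hn, Finset.mem_inter.2 ⟨hxn, hxP⟩⟩)
  have h₁ := (Finset.card_le_card hsub).trans (Finset.card_union_le _ _)
  have h₂ : (((A.erase a).filter fun n => r n a).biUnion fun n => C n ∩ P).card ≤ d * q :=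
    (Finset.card_biUnion_le_card_mul _ _ q fun n _ => hsmall n).trans
      (Nat.mul_le_mul_right _ (hd a _ fun y hy => (Finset.mem_filter.1 hy).2))
  rw [Finset.card_singleton] at h₁
  omega

/-- A connected set of bounded degree with many elements of `P` contains `t` disjoint connected
pieces with at least `q` elements of `P` each. -/
theorem ConnectedIn.exists_pieces [Fintype V] (hr : ∀ x y, r x y → r y x) {d q : ℕ}
    (hd : ∀ x : V, ∀ D : Finset V, (∀ y ∈ D, r y x) → D.card ≤ d) (hq : 0 < q) (t : ℕ)
    {S P : Finset V} (hS : ConnectedIn r S) (hP : t * ((d + 1) * q + 1) ≤ (S ∩ P).card) :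
    ∃ A : Fin t → Finset V, (∀ i, A i ⊆ S) ∧ (∀ i, ConnectedIn r (A i)) ∧
      (∀ i, q ≤ (A i ∩ P).card) ∧ ∀ i j, i ≠ j → Disjoint (A i) (A j) := by
  induction t generalizing S with
  | zero => exact ⟨fun _ => ∅, fun i => i.elim0, fun i => i.elim0, fun i => i.elim0,
      fun i => i.elim0⟩
  | succ t ih =>
    have hc : (d + 1) * q + 1 = d * q + q + 1 := by ring
    rw [Nat.succ_mul] at hP
    obtain ⟨A, hAS, hA, hA', hAq, hAq'⟩ := hS.exists_piece hr hd hq (P := P) (by omega)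
    have hcard : (S ∩ P).card ≤ (A ∩ P).card + ((S \ A) ∩ P).card := by
      refine (Finset.card_le_card ?_).trans (Finset.card_union_le _ _)
      intro x hx
      obtain ⟨h, h'⟩ := Finset.mem_inter.1 hx
      by_cases hxA : x ∈ A <;> simp [h, h', hxA]
    obtain ⟨B, h₁, h₂, h₃, h₄⟩ := ih hA' (by omega)
    refine ⟨Fin.cons A B, ?_, ?_, ?_, ?_⟩
    · exact Fin.cases hAS fun i => (h₁ i).trans Finset.sdiff_subset
    · exact Fin.cases hA h₂
    · exact Fin.cases hAq h₃
    · have hdis : ∀ i, Disjoint A (B i) := fun i =>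
        (Finset.disjoint_sdiff).mono_right (h₁ i)
      intro i j hij
      induction i using Fin.cases with
      | zero =>
        induction j using Fin.cases with
        | zero => exact absurd rfl hij
        | succ j => exact hdis j
      | succ i =>
        induction j using Fin.cases with
        | zero => exact (hdis i).symm
        | succ j => exact h₄ i j fun h => hij (by rw [h])

end Connected

/-! ### Connected sets with many common neighbours -/

section Mader

universe u

variable {Q : Type u} [DecidableEq Q] (R : SimpleGraph Q) [DecidableRel R.Adj]

/-- The number of ordered pairs of adjacent vertices of `W`. -/
def adjPairs (W : Finset Q) : ℕ := ∑ a ∈ W, (W.filter (R.Adj a)).card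

/-- The vertices of `W` outside `U` with a neighbour in `U`. -/
def boundary (W U : Finset Q) : Finset Q := (W \ U).filter fun a => ∃ b ∈ U, R.Adj a b

variable {R}

lemma adjPairs_erase {W : Finset Q} {a : Q} (ha : a ∈ W) :
    adjPairs R W = adjPairs R (W.erase a) + 2 * (W.filter (R.Adj a)).card := by
  have h₁ : ∀ b ∈ W.erase a, (W.filter (R.Adj b)).card =
      ((W.erase a).filter (R.Adj b)).card + if R.Adj a b then 1 else 0 := by
    intro b _
    rw [Finset.filter_erase]
    by_cases hab : R.Adj a b
    · rw [if_pos hab, Finset.card_erase_add_one]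
      exact Finset.mem_filter.2 ⟨ha, hab.symm⟩
    · rw [if_neg hab, Finset.erase_eq_of_notMem, add_zero]
      exact fun h => hab (Finset.mem_filter.1 h).2.symm
  have h₂ : (W.erase a).filter (R.Adj a) = W.filter (R.Adj a) := by
    rw [Finset.filter_erase, Finset.erase_eq_of_notMem]
    simp
  rw [adjPairs, adjPairs, ← Finset.add_sum_erase W _ ha, Finset.sum_congr rfl h₁,
    Finset.sum_add_distrib, ← Finset.card_filter, h₂]
  ring

/-- Contracting a further boundary vertex `a` into `U` loses the edge between them and one edge for
each neighbour of `a` in the boundary. -/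
lemma adjPairs_add_boundary_insert {W U : Finset Q} {a : Q} (ha : a ∈ boundary R W U) :
    adjPairs R (W \ U) + 2 * (boundary R W U).card =
      adjPairs R (W \ insert a U) + 2 * (boundary R W (insert a U)).card +
        2 * (1 + ((boundary R W U).filter (R.Adj a)).card) := by
  obtain ⟨haW, b, hb, hab⟩ := Finset.mem_filter.1 ha
  have h₁ : W \ insert a U = (W \ U).erase a := by
    ext x; simp only [Finset.mem_sdiff, Finset.mem_insert, Finset.mem_erase]; tauto
  have h₂ : boundary R W (insert a U) =
      (boundary R W U).erase a ∪ (W \ U).filter (R.Adj a) := by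
    ext x
    simp only [boundary, h₁, Finset.mem_filter, Finset.mem_erase, Finset.mem_union,
      Finset.exists_mem_insert]
    constructor
    · rintro ⟨⟨hxa, hx⟩, h | h⟩
      · exact Or.inr ⟨hx, h.symm⟩
      · exact Or.inl ⟨hxa, hx, h⟩
    · rintro (⟨hxa, hx, h⟩ | ⟨hx, h⟩)
      · exact ⟨⟨hxa, hx⟩, Or.inr h⟩
      · exact ⟨⟨h.ne', hx⟩, Or.inl h.symm⟩
  have h₃ : (boundary R W U).erase a ∩ (W \ U).filter (R.Adj a) =
      (boundary R W U).filter (R.Adj a) := by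
    ext x
    simp only [boundary, Finset.mem_inter, Finset.mem_filter, Finset.mem_erase]
    constructor
    · rintro ⟨⟨_, hx, h⟩, _, h'⟩; exact ⟨⟨hx, h⟩, h'⟩
    · rintro ⟨⟨hx, h⟩, h'⟩; exact ⟨⟨h'.ne', hx, h⟩, hx, h'⟩
  have h₄ := Finset.card_union_add_card_inter ((boundary R W U).erase a)
    ((W \ U).filter (R.Adj a))
  rw [← h₂, h₃] at h₄
  have h₅ := Finset.card_erase_add_one ha
  rw [adjPairs_erase haW, h₁]
  omega

/-- Mader's contraction argument: a graph of large average degree contains a nonempty connected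
set `U` whose set of neighbours induces a graph of half that degree. -/
lemma exists_connected_boundary {D : ℕ} (hD : 0 < D) {W : Finset Q} (hW : W.Nonempty)
    (h : 2 * D * W.card ≤ adjPairs R W) :
    ∃ U ⊆ W, ∃ B ⊆ W \ U, B.Nonempty ∧ ConnectedIn R.Adj U ∧ (∀ z ∈ B, ∃ u ∈ U, R.Adj z u) ∧
      D * B.card ≤ adjPairs R B := by
  classical
  induction hn : W.card using Nat.strong_induction_on generalizing W with
  | _ n ih =>
  subst hn
  -- `good U` says that contracting `U` to a vertex keeps the density; a largest such `U` is taken.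
  let good : Finset Q → Prop := fun U => U.Nonempty ∧ ConnectedIn R.Adj U ∧
    2 * D * ((W \ U).card + 1) ≤ adjPairs R (W \ U) + 2 * (boundary R W U).card
  obtain ⟨x, hx⟩ := hW
  have hgood : good {x} := by
    refine ⟨Finset.singleton_nonempty x, ?_, ?_⟩
    · intro a ha b hb
      rw [Finset.mem_singleton] at ha hb
      rw [ha, hb]
    · have h₁ : W \ {x} = W.erase x := Finset.sdiff_singleton_eq_erase x W
      have h₂ : boundary R W {x} = W.filter (R.Adj x) := by
        ext a
        simp only [boundary, h₁, Finset.mem_filter, Finset.mem_erase, Finset.mem_singleton,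
          exists_eq_left]
        constructor
        · rintro ⟨⟨_, ha⟩, h⟩; exact ⟨ha, h.symm⟩
        · rintro ⟨ha, h⟩; exact ⟨⟨h.ne', ha⟩, h.symm⟩
      rw [h₁, h₂, ← adjPairs_erase hx, Finset.card_erase_add_one hx]
      exact h
  obtain ⟨U, hU, hmax⟩ := Finset.exists_max_image (W.powerset.filter good) Finset.card
    ⟨{x}, by simp [hx, hgood]⟩
  simp only [Finset.mem_filter, Finset.mem_powerset] at hU hmax
  obtain ⟨hUW, hUne, hUc, hUe⟩ := hU
  by_cases hB : (boundary R W U).Nonempty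
  · refine ⟨U, hUW, boundary R W U, Finset.filter_subset _ _, hB, hUc,
      fun z hz => (Finset.mem_filter.1 hz).2, ?_⟩
    rw [adjPairs, mul_comm, ← smul_eq_mul]
    refine Finset.card_nsmul_le_sum _ _ _ fun a ha => ?_
    obtain ⟨haW, b, hb, hab⟩ := Finset.mem_filter.1 ha
    obtain ⟨haW, haU⟩ := Finset.mem_sdiff.1 haW
    by_contra! hlt
    have hbad : good (insert a U) := by
      refine ⟨Finset.insert_nonempty _ _, ?_, ?_⟩
      · refine connectedIn_of_hub (fun _ _ h => h.symm) b fun y hy => ?_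
        rcases Finset.mem_insert.1 hy with rfl | hy
        · exact .single ⟨Finset.mem_insert_self _ _, Finset.mem_insert_of_mem hb, hab⟩
        · exact reflTransGen_inside_mono (Finset.subset_insert _ _) (hUc y hy b hb)
      · have h₁ := adjPairs_add_boundary_insert ha
        have h₂ : (W \ insert a U).card + 1 = (W \ U).card := by
          have : W \ insert a U = (W \ U).erase a := by
            ext x; simp only [Finset.mem_sdiff, Finset.mem_insert, Finset.mem_erase]; tauto
          rw [this, Finset.card_erase_add_one (Finset.mem_sdiff.2 ⟨haW, haU⟩)]
        rw [h₂]
        rw [mul_add] at hUe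
        omega
    have h₁ := hmax (insert a U) ⟨Finset.insert_subset haW hUW, hbad⟩
    rw [Finset.card_insert_of_notMem haU] at h₁
    omega
  · -- Without a boundary, `U` is a union of components, and the rest is denser.
    rw [Finset.not_nonempty_iff_eq_empty] at hB
    rw [hB, Finset.card_empty, mul_zero, add_zero, mul_add] at hUe
    have hlt : (W \ U).card < W.card := Finset.card_lt_card
      (Finset.sdiff_ssubset hUW hUne)
    have hne : (W \ U).Nonempty := by
      rw [Finset.nonempty_iff_ne_empty]
      intro h0
      rw [h0] at hUe
      simp [adjPairs] at hUe
      omega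
    obtain ⟨U', h₁, B, h₂, h₃⟩ := ih _ hlt hne (by omega) rfl
    exact ⟨U', h₁.trans Finset.sdiff_subset, B,
      h₂.trans (Finset.sdiff_subset_sdiff Finset.sdiff_subset Finset.Subset.rfl), h₃⟩

/-- A graph of large average degree contains disjoint connected sets `U j` and a set `Z` disjoint
from them such that every element of `Z` has a neighbour in every `U j`. -/
theorem exists_connected_of_adjPairs {n : ℕ} (hn : 0 < n) (N : ℕ) {W : Finset Q}
    (hW : W.Nonempty) (h : 2 ^ N * n * W.card ≤ adjPairs R W) :
    ∃ (U : Fin N → Finset Q) (Z : Finset Q), n ≤ Z.card ∧ Z ⊆ W ∧ (∀ j, U j ⊆ W) ∧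
      (∀ j, Disjoint Z (U j)) ∧ (∀ i j, i ≠ j → Disjoint (U i) (U j)) ∧
      (∀ j, ConnectedIn R.Adj (U j)) ∧ ∀ j, ∀ z ∈ Z, ∃ u ∈ U j, R.Adj z u := by
  induction N generalizing W with
  | zero =>
    refine ⟨fun j => j.elim0, W, ?_, Finset.Subset.rfl, fun j => j.elim0, fun j => j.elim0,
      fun j => j.elim0, fun j => j.elim0, fun j => j.elim0⟩
    obtain ⟨a, -, ha⟩ := Finset.exists_le_of_sum_le hW (f := fun _ => n)
      (g := fun a => (W.filter (R.Adj a)).card)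
      (by rw [Finset.sum_const, smul_eq_mul]; simpa [adjPairs, mul_comm] using h)
    exact ha.trans (Finset.card_filter_le _ _)
  | succ N ih =>
    obtain ⟨U, hUW, B, hBW, hBne, hUc, hBU, hB⟩ := exists_connected_boundary
      (D := 2 ^ N * n) (by positivity) hW (by rw [← mul_assoc, ← pow_succ']; exact h)
    obtain ⟨U', Z, h₁, h₂, h₃, h₄, h₅, h₆, h₇⟩ := ih hBne hB
    have hBU' : Disjoint B U := (Finset.sdiff_disjoint).mono_left hBW
    refine ⟨Fin.cons U U', Z, h₁, (h₂.trans hBW).trans Finset.sdiff_subset, ?_, ?_, ?_, ?_, ?_⟩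
    · exact Fin.cases hUW fun j => ((h₃ j).trans hBW).trans Finset.sdiff_subset
    · exact Fin.cases (hBU'.mono_left h₂) h₄
    · intro i j hij
      induction i using Fin.cases with
      | zero =>
        induction j using Fin.cases with
        | zero => exact absurd rfl hij
        | succ j => exact (hBU'.mono_left (h₃ j)).symm
      | succ i =>
        induction j using Fin.cases with
        | zero => exact hBU'.mono_left (h₃ i)
        | succ j => exact h₅ i j fun h => hij (by rw [h])
    · exact Fin.cases hUc h₆
    · exact Fin.cases (fun z hz => hBU z (h₂ hz)) h₇

end Mader

/-! ### Stars in weighted graphs -/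

section Star

universe u

variable {V : Type u} [Fintype V] [DecidableEq V]

/-- There is an integral flow below the weight function `w` which sends `k` units from each of `t`
distinct vertices to a further vertex, and which does not enter the `t` sources. -/
def HasStar (w : V → V → ℤ) (t k : ℕ) : Prop :=
  ∃ (y : Fin t → V) (v : V) (ψ : V → V → ℤ), Function.Injective y ∧ (∀ i, y i ≠ v) ∧
    IsFlow ψ ∧ (∀ x z, ψ x z ≤ w x z) ∧
    (∀ x, outflow ψ x = ∑ p : Fin t × Fin k, demand (y p.1) v x) ∧ ∀ i z, 0 ≤ ψ (y i) z

/-- The graph of the pairs of weight at least `m`. -/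
def heavyGraph (w : V → V → ℤ) (m : ℤ) : SimpleGraph V where
  Adj x z := x ≠ z ∧ m ≤ w x z ∧ m ≤ w z x
  symm := ⟨fun _ _ h => ⟨h.1.symm, h.2.2, h.2.1⟩⟩
  loopless := ⟨fun _ h => h.1 rfl⟩

/-- A star can be assembled from paths, one for each unit of its flow, if a light pair is used by
at most one of them. -/
lemma hasStar_of_relations {w : V → V → ℤ} {t k : ℕ} {m : ℤ} (hm : (t * k : ℕ) ≤ m)
    (hw : ∀ x z, 0 ≤ w x z) {y : Fin t → V} {v : V} (hy : Function.Injective y)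
    (hyv : ∀ i, y i ≠ v) (r : Fin t × Fin k → V → V → Prop)
    (hreach : ∀ p, Relation.ReflTransGen (r p) (y p.1) v) (hpos : ∀ p x z, r p x z → 0 < w x z)
    (hlight : ∀ p p' x z, r p x z → r p' x z → w x z < m → p' = p)
    (havoid : ∀ p i x, r p x (y i) → i = p.1) : HasStar w t k := by
  choose l hl using fun p => IsSimplePath.exists_of_reflTransGen (hreach p)
  refine ⟨y, v, fun x z => ∑ p, pathFlow (l p) x z, hy, hyv, ?_, ?_, ?_, ?_⟩
  · intro x z
    dsimp only
    rw [← Finset.sum_neg_distrib]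
    exact Finset.sum_congr rfl fun p _ => isFlow_pathFlow _ _ _
  · intro x z
    have h1 : ∀ p, pathFlow (l p) x z ≤ 1 := fun p => (pathFlow_spec (hl p) x z).1
    have h0 : ∀ p, ¬ r p x z → pathFlow (l p) x z ≤ 0 := fun p hp => by
      by_contra! h
      exact hp ((pathFlow_spec (hl p) x z).2.1 h)
    by_cases hex : ∃ p, r p x z
    · obtain ⟨p, hp⟩ := hex
      by_cases hwm : w x z < m
      · calc ∑ p, pathFlow (l p) x z ≤ ∑ p', if p' = p then 1 else 0 := by
              refine Finset.sum_le_sum fun p' _ => ?_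
              split_ifs with h
              · exact h1 p'
              · exact h0 p' fun hp' => h (hlight p p' x z hp hp' hwm)
          _ = 1 := by simp
          _ ≤ w x z := hpos p x z hp
      · refine (Finset.sum_le_card_nsmul _ _ 1 fun p _ => h1 p).trans ?_
        have : (Finset.univ : Finset (Fin t × Fin k)).card = t * k := by simp
        rw [this, nsmul_eq_mul, mul_one]
        exact hm.trans (not_lt.1 hwm)
    · push Not at hex
      exact (Finset.sum_nonpos fun p _ => h0 p (hex p)).trans (hw x z)
  · intro x
    rw [outflow, Finset.sum_comm]
    exact Finset.sum_congr rfl fun p _ => outflow_pathFlow (hl p) x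
  · intro i z
    refine Finset.sum_nonneg fun p _ => ?_
    by_cases hi : i = p.1
    · rw [hi]; exact (pathFlow_spec (hl p) (y p.1) z).2.2
    · rw [pathFlow_eq_zero_left]
      intro hmem
      rcases (hl p).eq_or_exists_rel hmem with h | ⟨x, hx⟩
      · exact hi (hy h)
      · exact hi (havoid p i x hx)

variable {w : V → V → ℤ} {m : ℤ}

/-- A vertex in `t` heavy pairs is the hub of a star. -/
lemma hasStar_of_degree {t k : ℕ} (hm : (t * k : ℕ) ≤ m) (hm0 : 0 < m)
    (hw : ∀ x z, 0 ≤ w x z) (v : V) (D : Finset V) (hD : ∀ y ∈ D, (heavyGraph w m).Adj y v)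
    (ht : t ≤ D.card) : HasStar w t k := by
  obtain ⟨e⟩ : Nonempty (Fin t ↪ D) :=
    Function.Embedding.nonempty_of_card_le (by simpa using ht)
  have hadj : ∀ i, (heavyGraph w m).Adj (e i) v := fun i => hD _ (e i).2
  refine hasStar_of_relations hm hw (y := fun i => (e i : V)) (v := v)
    (fun i j h => e.injective (Subtype.ext h)) (fun i => (hadj i).1)
    (fun p x z => x = e p.1 ∧ z = v) (fun p => .single ⟨rfl, rfl⟩) ?_ ?_ ?_
  · rintro p x z ⟨rfl, rfl⟩
    exact hm0.trans_le (hadj _).2.1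
  · rintro p p' x z ⟨rfl, rfl⟩ - h
    exact absurd (hadj p.1).2.1 (not_le.2 h)
  · rintro p i x ⟨-, h⟩
    exact absurd h (hadj i).1

omit [Fintype V] [DecidableEq V] in
lemma ConnectedIn.reflTransGen {r s : V → V → Prop} {S : Finset V} (h : ConnectedIn r S)
    (hrs : ∀ x z, x ∈ S → z ∈ S → r x z → s x z) {x z : V} (hx : x ∈ S) (hz : z ∈ S) :
    Relation.ReflTransGen s x z :=
  Relation.ReflTransGen.mono (fun a b hab => hrs a b hab.1 hab.2.1 hab.2.2) _ _ (h x hx z hz)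

/-- Two disjoint heavily connected sets joined by light pairs at many different vertices of the
first one yield a star: its sources lie in disjoint pieces of the first set, and its flow is
collected in the second one. -/
lemma hasStar_of_boundary {t k : ℕ} (hm : (t * k : ℕ) ≤ m) (hm0 : 0 < m)
    (hw : ∀ x z, 0 ≤ w x z) {B C : Finset V} (hBC : Disjoint B C)
    (hB : ConnectedIn (heavyGraph w m).Adj B) (hC : ConnectedIn (heavyGraph w m).Adj C)
    (hCne : C.Nonempty)
    (hP : t * ((t + 1) * (k + 1) + 1) ≤ (B.filter fun x => ∃ z ∈ C, 0 < w x z).card) :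
    HasStar w t k := by
  by_cases hdeg : ∃ v : V, ∃ D : Finset V, (∀ y ∈ D, (heavyGraph w m).Adj y v) ∧ t < D.card
  · obtain ⟨v, D, hD, ht⟩ := hdeg
    exact hasStar_of_degree hm hm0 hw v D hD ht.le
  push Not at hdeg
  obtain ⟨v, hv⟩ := hCne
  obtain ⟨P, hPdef⟩ : ∃ P, P = B.filter fun x => ∃ z ∈ C, 0 < w x z := ⟨_, rfl⟩
  have hPB : P ⊆ B := hPdef ▸ Finset.filter_subset _ _
  have hPC : ∀ x ∈ P, ∃ z ∈ C, 0 < w x z := fun x hx => by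
    rw [hPdef] at hx
    exact (Finset.mem_filter.1 hx).2
  rw [← hPdef] at hP
  obtain ⟨A, hAB, hA, hAP, hdisj⟩ := hB.exists_pieces (fun _ _ h => h.symm) (d := t)
    (q := k + 1) (P := P) hdeg (by omega) t (by rwa [Finset.inter_eq_right.2 hPB])
  obtain ⟨e⟩ : Nonempty (∀ i, Fin k ↪ (A i ∩ P : Finset V)) :=
    Classical.nonempty_pi.2 fun i => Function.Embedding.nonempty_of_card_le (by
      have := hAP i
      simp only [Fintype.card_fin, Fintype.card_coe]
      omega)
  have heA : ∀ i j, (e i j : V) ∈ A i := fun i j => (Finset.mem_inter.1 (e i j).2).1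
  have heP : ∀ i j, ∃ z ∈ C, 0 < w (e i j) z := fun i j =>
    hPC _ (Finset.mem_inter.1 (e i j).2).2
  choose q hqC hq using heP
  have hAne : ∀ i, ∃ a, a ∈ A i := fun i => by
    have : 0 < (A i ∩ P).card := by have := hAP i; omega
    obtain ⟨a, ha⟩ := Finset.card_pos.1 this
    exact ⟨a, (Finset.mem_inter.1 ha).1⟩
  choose y hy using hAne
  have hAeq : ∀ i j x, x ∈ A i → x ∈ A j → i = j := fun i j x hi hj => by
    by_contra hij
    exact Finset.disjoint_left.1 (hdisj i j hij) hi hj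
  have hBC' : ∀ x i, x ∈ A i → x ∉ C := fun x i hx =>
    Finset.disjoint_left.1 hBC (hAB i hx)
  -- The path `(i, j)` runs in the piece `A i` to its `j`-th boundary vertex, crosses to `C` along
  -- its own pair, and runs to the hub in `C`.
  refine hasStar_of_relations hm hw (y := y) (v := v)
    (fun i j h => hAeq i j (y i) (hy i) (h ▸ hy j)) (fun i h => hBC' _ i (hy i) (h ▸ hv))
    (fun p x z => ((heavyGraph w m).Adj x z ∧ ((x ∈ A p.1 ∧ z ∈ A p.1) ∨ (x ∈ C ∧ z ∈ C))) ∨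
      (x = e p.1 p.2 ∧ z = q p.1 p.2)) ?_ ?_ ?_ ?_
  · intro p
    refine ((hA p.1).reflTransGen (fun x z hx hz h => Or.inl ⟨h, Or.inl ⟨hx, hz⟩⟩) (hy p.1)
      (heA p.1 p.2)).trans (.head (Or.inr ⟨rfl, rfl⟩)
      (hC.reflTransGen (fun x z hx hz h => Or.inl ⟨h, Or.inr ⟨hx, hz⟩⟩) (hqC _ _) hv))
  · rintro p x z (⟨h, -⟩ | ⟨rfl, rfl⟩)
    · exact hm0.trans_le h.2.1
    · exact hq _ _
  · rintro p p' x z (⟨h, -⟩ | ⟨rfl, rfl⟩) h' hlt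
    · exact absurd h.2.1 (not_le.2 hlt)
    · rcases h' with ⟨h, -⟩ | ⟨h₁, -⟩
      · exact absurd h.2.1 (not_le.2 hlt)
      · have h₂ := hAeq p.1 p'.1 _ (heA p.1 p.2) (h₁ ▸ heA p'.1 p'.2)
        obtain ⟨i, j⟩ := p
        obtain ⟨i', j'⟩ := p'
        obtain rfl : i = i' := h₂
        exact congrArg _ ((e i).injective (Subtype.ext h₁.symm))
  · rintro p i x (⟨-, ⟨-, h⟩ | ⟨-, h⟩⟩ | ⟨-, h⟩)
    · exact hAeq i p.1 _ (hy i) h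
    · exact absurd h (hBC' _ i (hy i))
    · exact absurd (h ▸ hqC p.1 p.2) (hBC' _ i (hy i))

/-- The graph on the components of `T` in which two components are adjacent if some pair between
them has positive weight. -/
def componentGraph (w : V → V → ℤ) (T : SimpleGraph V) : SimpleGraph T.ConnectedComponent where
  Adj c c' := c ≠ c' ∧ ∃ x z, T.connectedComponentMk x = c ∧ T.connectedComponentMk z = c' ∧
    0 < w x z ∧ 0 < w z x
  symm := ⟨fun _ _ ⟨h, x, z, hx, hz, h₁, h₂⟩ => ⟨h.symm, z, x, hz, hx, h₂, h₁⟩⟩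
  loopless := ⟨fun _ h => h.1 rfl⟩

omit [Fintype V] [DecidableEq V] in
lemma reflTransGen_of_connectedComponentMk_eq {T : SimpleGraph V} {s : V → V → Prop} {x z : V}
    (h : T.connectedComponentMk x = T.connectedComponentMk z)
    (hs : ∀ a b, T.Adj a b → T.connectedComponentMk a = T.connectedComponentMk x →
      T.connectedComponentMk b = T.connectedComponentMk x → s a b) :
    Relation.ReflTransGen s x z := by
  have hreach := (SimpleGraph.reachable_iff_reflTransGen x z).1
    (SimpleGraph.ConnectedComponent.exact h)
  clear h
  induction hreach with
  | refl => exact .refl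
  | @tail b c hxb hbc ih =>
    have hb := SimpleGraph.ConnectedComponent.sound
      ((SimpleGraph.reachable_iff_reflTransGen x b).2 hxb)
    exact ih.tail (hs b c hbc hb.symm
      ((SimpleGraph.ConnectedComponent.sound hbc.reachable).symm.trans hb.symm))

/-- Pairwise disjoint connected sets of components with enough common neighbours yield a star. -/
lemma hasStar_of_connected_components {t k : ℕ} (hm : (t * k : ℕ) ≤ m) (hm0 : 0 < m)
    (hw : ∀ x z, 0 ≤ w x z)
    (U : Fin t × Fin k → Finset (heavyGraph w m).ConnectedComponent)
    (c : Fin t → (heavyGraph w m).ConnectedComponent) (b : (heavyGraph w m).ConnectedComponent)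
    (hc : Function.Injective c) (hcb : ∀ i, c i ≠ b) (hcU : ∀ i p, c i ∉ U p)
    (hbU : ∀ p, b ∉ U p) (hdisj : ∀ p p', p ≠ p' → Disjoint (U p) (U p'))
    (hconn : ∀ p, ConnectedIn (componentGraph w (heavyGraph w m)).Adj (U p))
    (hadj : ∀ p i, ∃ d ∈ U p, (componentGraph w (heavyGraph w m)).Adj (c i) d)
    (hadj' : ∀ p, ∃ d ∈ U p, (componentGraph w (heavyGraph w m)).Adj b d) :
    HasStar w t k := by
  let T := heavyGraph w m
  let κ : V → T.ConnectedComponent := T.connectedComponentMk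
  choose y hy using fun i => (c i).exists_rep
  obtain ⟨v, hv⟩ := b.exists_rep
  change ∀ i, κ (y i) = c i at hy
  change κ v = b at hv
  have hκ : ∀ x z, T.Adj x z → κ x = κ z := fun x z h =>
    SimpleGraph.ConnectedComponent.sound h.reachable
  -- The path `p` uses heavy pairs in the component of its source and in that of the hub; its other
  -- steps have an end in a component belonging to `U p`.
  let r : Fin t × Fin k → V → V → Prop := fun p x z =>
    (T.Adj x z ∧ (κ x = c p.1 ∨ κ x = b)) ∨ (0 < w x z ∧ (κ x ∈ U p ∨ κ z ∈ U p) ∧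
      (κ x = c p.1 ∨ κ x ∈ U p) ∧ (κ z ∈ U p ∨ κ z = b))
  refine hasStar_of_relations hm hw (y := y) (v := v)
    (fun i j h => hc (by rw [← hy i, ← hy j, h])) (fun i h => hcb i (by rw [← hy, ← hv, h]))
    r ?_ ?_ ?_ ?_
  · intro p
    have hinU : ∀ x z, κ x ∈ U p → κ x = κ z → Relation.ReflTransGen (r p) x z := by
      intro x z hx hxz
      refine reflTransGen_of_connectedComponentMk_eq hxz fun a b hab ha hb => Or.inr ?_
      have ha' : κ a ∈ U p := by rw [show κ a = κ x from ha]; exact hx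
      have hb' : κ b ∈ U p := by rw [show κ b = κ x from hb]; exact hx
      exact ⟨hm0.trans_le hab.2.1, Or.inl ha', Or.inr ha', Or.inl hb'⟩
    have hU : ∀ d d', Relation.ReflTransGen
        (Inside (componentGraph w (heavyGraph w m)).Adj (U p)) d d' → d ∈ U p →
        ∀ x z, κ x = d → κ z = d' → Relation.ReflTransGen (r p) x z := by
      intro d d' h hd
      induction h with
      | refl =>
        intro x z hx hz
        exact hinU x z (by rw [hx]; exact hd) (hx.trans hz.symm)
      | tail _ hstep ih =>
        intro x z hx hz
        obtain ⟨hf, hg, -, x', z', hx', hz', hpos, -⟩ := hstep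
        have hx'U : κ x' ∈ U p := by rw [show κ x' = _ from hx']; exact hf
        have hz'U : κ z' ∈ U p := by rw [show κ z' = _ from hz']; exact hg
        exact ((ih x x' hx hx').tail
          (Or.inr ⟨hpos, Or.inl hx'U, Or.inr hx'U, Or.inl hz'U⟩)).trans
          (hinU z' z hz'U ((show κ z' = _ from hz').trans hz.symm))
    obtain ⟨d, hd, -, x, z, hx, hz, hpos, -⟩ := hadj p p.1
    obtain ⟨d', hd', -, x', z', hx', hz', -, hpos'⟩ := hadj' p
    change κ x = _ at hx
    change κ z = _ at hz
    change κ x' = _ at hx'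
    change κ z' = _ at hz'
    have h₁ : Relation.ReflTransGen (r p) (y p.1) x := by
      refine reflTransGen_of_connectedComponentMk_eq ((hy p.1).trans hx.symm)
        fun a b hab ha _ => Or.inl ⟨hab, Or.inl ?_⟩
      exact (show κ a = κ (y p.1) from ha).trans (hy p.1)
    have h₂ : r p x z := Or.inr ⟨hpos, Or.inr (hz ▸ hd), Or.inl hx, Or.inl (hz ▸ hd)⟩
    have h₃ : Relation.ReflTransGen (r p) z z' := hU d d' (hconn p d hd d' hd') hd z z' hz hz'
    have h₄ : r p z' x' := Or.inr ⟨hpos', Or.inl (hz' ▸ hd'), Or.inr (hz' ▸ hd'), Or.inr hx'⟩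
    have h₅ : Relation.ReflTransGen (r p) x' v := by
      refine reflTransGen_of_connectedComponentMk_eq (hx'.trans hv.symm)
        fun a b hab ha _ => Or.inl ⟨hab, Or.inr ?_⟩
      exact (show κ a = κ x' from ha).trans hx'
    exact ((h₁.tail h₂).trans (h₃.tail h₄)).trans h₅
  · rintro p x z (⟨h, -⟩ | ⟨h, -⟩)
    · exact hm0.trans_le h.2.1
    · exact h
  · rintro p p' x z (⟨h, -⟩ | ⟨-, h₁, -, -⟩) h' hlt
    · exact absurd h.2.1 (not_le.2 hlt)
    · rcases h' with ⟨h, -⟩ | ⟨-, -, h₂, h₃⟩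
      · exact absurd h.2.1 (not_le.2 hlt)
      · by_contra hpp
        have hd := Finset.disjoint_left.1 (hdisj p p' (Ne.symm hpp))
        rcases h₁ with h₁ | h₁
        · rcases h₂ with h₂ | h₂
          · exact hcU p'.1 p (h₂ ▸ h₁)
          · exact hd h₁ h₂
        · rcases h₃ with h₃ | h₃
          · exact hd h₁ h₃
          · exact hbU p (h₃ ▸ h₁)
  · rintro p i x (⟨h, h₁⟩ | ⟨-, -, -, h₁⟩)
    · rw [hκ x _ h, hy] at h₁
      rcases h₁ with h₁ | h₁
      · exact hc h₁
      · exact absurd h₁ (hcb i)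
    · rw [hy] at h₁
      rcases h₁ with h₁ | h₁
      · exact absurd h₁ (hcU i p)
      · exact absurd h₁ (hcb i)

/-- The total weight between two heavily connected sets without heavy pairs between them is
bounded unless there is a star. -/
lemma sum_le_or_hasStar {t k : ℕ} (hm : (t * k : ℕ) ≤ m) (hm0 : 0 < m)
    (hs : ∀ x z, w x z = w z x) (hw : ∀ x z, 0 ≤ w x z) {B C : Finset V} (hBC : Disjoint B C)
    (hB : ConnectedIn (heavyGraph w m).Adj B) (hC : ConnectedIn (heavyGraph w m).Adj C)
    (hBne : B.Nonempty) (hCne : C.Nonempty)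
    (hlight : ∀ x ∈ B, ∀ z ∈ C, ¬ (heavyGraph w m).Adj x z) :
    HasStar w t k ∨ ∑ x ∈ B, ∑ z ∈ C, w x z ≤ ((t * ((t + 1) * (k + 1) + 1)) ^ 2 : ℕ) * m := by
  by_cases h₁ : t * ((t + 1) * (k + 1) + 1) ≤ (B.filter fun x => ∃ z ∈ C, 0 < w x z).card
  · exact Or.inl (hasStar_of_boundary hm hm0 hw hBC hB hC hCne h₁)
  by_cases h₂ : t * ((t + 1) * (k + 1) + 1) ≤ (C.filter fun x => ∃ z ∈ B, 0 < w x z).card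
  · exact Or.inl (hasStar_of_boundary hm hm0 hw hBC.symm hC hB hBne h₂)
  right
  push Not at h₁ h₂
  obtain ⟨N, hN⟩ : ∃ N, N = t * ((t + 1) * (k + 1) + 1) := ⟨_, rfl⟩
  rw [← hN] at h₁ h₂ ⊢
  have hle : ∀ x ∈ B, ∀ z ∈ C, w x z ≤ m := by
    intro x hx z hz
    by_contra! hlt
    exact hlight x hx z hz ⟨by rintro rfl; exact Finset.disjoint_left.1 hBC hx hz, hlt.le,
      by rw [hs]; exact hlt.le⟩
  have hrow : ∀ x ∈ B, ∑ z ∈ C, w x z ≤ N * m := by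
    intro x hx
    calc ∑ z ∈ C, w x z = ∑ z ∈ C.filter fun z => ∃ x ∈ B, 0 < w z x, w x z := by
          refine (Finset.sum_subset (Finset.filter_subset _ _) fun z hz hz' => ?_).symm
          by_contra hne
          exact hz' (Finset.mem_filter.2 ⟨hz, x, hx, by
            rw [hs]; exact lt_of_le_of_ne (hw x z) (Ne.symm hne)⟩)
      _ ≤ (C.filter fun z => ∃ x ∈ B, 0 < w z x).card • m :=
          Finset.sum_le_card_nsmul _ _ _ fun z hz => hle x hx z (Finset.mem_filter.1 hz).1
      _ ≤ N * m := by
          rw [nsmul_eq_mul]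
          exact mul_le_mul_of_nonneg_right (by exact_mod_cast h₂.le) hm0.le
  calc ∑ x ∈ B, ∑ z ∈ C, w x z
      = ∑ x ∈ B.filter fun x => ∃ z ∈ C, 0 < w x z, ∑ z ∈ C, w x z := by
        refine (Finset.sum_subset (Finset.filter_subset _ _) fun x hx hx' => ?_).symm
        refine Finset.sum_eq_zero fun z hz => ?_
        by_contra hne
        exact hx' (Finset.mem_filter.2 ⟨hx, z, hz, lt_of_le_of_ne (hw x z) (Ne.symm hne)⟩)
    _ ≤ (B.filter fun x => ∃ z ∈ C, 0 < w x z).card • (N * m) :=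
        Finset.sum_le_card_nsmul _ _ _ fun x hx => hrow x (Finset.mem_filter.1 hx).1
    _ ≤ N * (N * m) := by
        rw [nsmul_eq_mul]
        exact mul_le_mul_of_nonneg_right (by exact_mod_cast h₁.le) (by positivity)
    _ = ((N ^ 2 : ℕ) : ℤ) * m := by push_cast; ring

/-- If all cuts are large and the heavy pairs do not connect the graph, there is a star: otherwise
the graph of components has large minimum degree. -/
lemma hasStar_of_large_cuts {t k : ℕ} (hm : (t * k : ℕ) ≤ m) (hm0 : 0 < m)
    (hs : ∀ x z, w x z = w z x) (hw : ∀ x z, 0 ≤ w x z)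
    (hcut : ∀ S : Finset V, S.Nonempty → Sᶜ.Nonempty →
      (2 ^ (t * k) * (t + 1) * (t * ((t + 1) * (k + 1) + 1)) ^ 2 : ℕ) * m < cutWeight w S)
    (hT : ¬ (heavyGraph w m).Preconnected) : HasStar w t k := by
  classical
  by_contra hstar
  let T := heavyGraph w m
  let κ : V → T.ConnectedComponent := T.connectedComponentMk
  let R := componentGraph w T
  let supp : T.ConnectedComponent → Finset V := fun c => Finset.univ.filter fun x => κ x = c
  have hmem : ∀ c x, x ∈ supp c ↔ κ x = c := fun c x => by simp [supp]
  have hne : ∀ c, (supp c).Nonempty := fun c => by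
    obtain ⟨x, hx⟩ := c.exists_rep
    exact ⟨x, (hmem c x).2 hx⟩
  have hconn : ∀ c, ConnectedIn T.Adj (supp c) := fun c x hx z hz => by
    rw [hmem] at hx hz
    refine reflTransGen_of_connectedComponentMk_eq (hx.trans hz.symm) fun a b hab ha hb =>
      ⟨(hmem _ _).2 (Eq.trans ha hx), (hmem _ _).2 (Eq.trans hb hx), hab⟩
  obtain ⟨L, hL⟩ : ∃ L : ℤ, L = ((t * ((t + 1) * (k + 1) + 1)) ^ 2 : ℕ) * m := ⟨_, rfl⟩
  have hL0 : 0 ≤ L := hL ▸ by positivity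
  have hpair : ∀ c c', c ≠ c' → ∑ x ∈ supp c, ∑ z ∈ supp c', w x z ≤
      if R.Adj c c' then L else 0 := by
    intro c c' hcc
    split_ifs with hadj
    · rw [hL]
      refine (sum_le_or_hasStar hm hm0 hs hw ?_ (hconn c) (hconn c') (hne c) (hne c')
        ?_).resolve_left hstar
      · rw [Finset.disjoint_left]
        intro x hx hx'
        rw [hmem] at hx hx'
        exact hcc (hx.symm.trans hx')
      · intro x hx z hz h
        rw [hmem] at hx hz
        exact hcc (hx.symm.trans ((SimpleGraph.ConnectedComponent.sound h.reachable).trans hz))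
    · refine Finset.sum_nonpos fun x hx => Finset.sum_nonpos fun z hz => ?_
      rw [hmem] at hx hz
      by_contra! hpos
      exact hadj ⟨hcc, x, z, hx, hz, hpos, by rwa [hs]⟩
  have hdeg : ∀ c, 2 ^ (t * k) * (t + 1) ≤ (Finset.univ.filter (R.Adj c)).card := by
    intro c
    have hcne : (supp c)ᶜ.Nonempty := by
      by_contra hemp
      rw [Finset.not_nonempty_iff_eq_empty, Finset.compl_eq_empty_iff] at hemp
      refine hT fun x z => SimpleGraph.ConnectedComponent.exact ?_
      have h₁ := (hmem c x).1 (by rw [hemp]; exact Finset.mem_univ x)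
      have h₂ := (hmem c z).1 (by rw [hemp]; exact Finset.mem_univ z)
      exact h₁.trans h₂.symm
    have h₁ := hcut (supp c) (hne c) hcne
    have h₂ : cutWeight w (supp c) ≤ (Finset.univ.filter (R.Adj c)).card * L := by
      calc cutWeight w (supp c)
          = ∑ x ∈ supp c, ∑ c' ∈ Finset.univ.erase c, ∑ z ∈ supp c', w x z := by
            refine Finset.sum_congr rfl fun x _ => ?_
            rw [← Finset.sum_fiberwise_of_maps_to (g := κ) (t := Finset.univ.erase c)]
            · refine Finset.sum_congr rfl fun c' hc' => Finset.sum_congr ?_ fun _ _ => rfl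
              ext z
              simp only [Finset.mem_filter, Finset.mem_compl, hmem]
              constructor
              · exact fun h => h.2
              · rintro rfl; exact ⟨Finset.ne_of_mem_erase hc', rfl⟩
            · intro z hz
              rw [Finset.mem_compl, hmem] at hz
              exact Finset.mem_erase.2 ⟨hz, Finset.mem_univ _⟩
        _ = ∑ c' ∈ Finset.univ.erase c, ∑ x ∈ supp c, ∑ z ∈ supp c', w x z := Finset.sum_comm
        _ ≤ ∑ c' ∈ Finset.univ.erase c, if R.Adj c c' then L else 0 :=
            Finset.sum_le_sum fun c' hc' => hpair c c' (Finset.ne_of_mem_erase hc').symm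
        _ ≤ ∑ c', if R.Adj c c' then L else 0 :=
            Finset.sum_le_sum_of_subset_of_nonneg (Finset.erase_subset _ _) fun c' _ _ => by
              split_ifs
              exacts [hL0, le_rfl]
        _ = (Finset.univ.filter (R.Adj c)).card * L := by
            rw [← Finset.sum_filter, Finset.sum_const, nsmul_eq_mul]
    by_contra! hlt
    have h₃ : ((Finset.univ.filter (R.Adj c)).card : ℤ) * L ≤
        ((2 ^ (t * k) * (t + 1) : ℕ) : ℤ) * L :=
      mul_le_mul_of_nonneg_right (by exact_mod_cast hlt.le) hL0
    rw [hL] at h₂ h₃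
    push_cast at h₁ h₂ h₃
    nlinarith
  have hV : Nonempty V := by
    by_contra h
    rw [not_nonempty_iff] at h
    exact hT fun x => h.elim x
  obtain ⟨x₀⟩ := hV
  -- `t` elements of `Z` contain the sources, and one more contains the hub.
  obtain ⟨U, Z, hZ, -, -, hZU, hUU, hUc, hZadj⟩ := exists_connected_of_adjPairs (R := R)
    (n := t + 1) (by omega) (t * k) (W := Finset.univ) ⟨κ x₀, Finset.mem_univ _⟩ (by
      rw [adjPairs, mul_comm, ← smul_eq_mul]
      exact Finset.card_nsmul_le_sum _ _ _ fun c _ => hdeg c)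
  obtain ⟨e⟩ : Nonempty (Fin (t + 1) ↪ Z) :=
    Function.Embedding.nonempty_of_card_le (by simpa using hZ)
  have heU : ∀ i j, (e i : T.ConnectedComponent) ∉ U j := fun i j =>
    Finset.disjoint_left.1 (hZU j) (e i).2
  refine hstar (hasStar_of_connected_components hm hm0 hw (fun p => U (finProdFinEquiv p))
    (fun i => e i.castSucc) (e (Fin.last t)) ?_ ?_ (fun i p => heU _ _) (fun p => heU _ _)
    (fun p p' hpp => hUU _ _ fun h => hpp (finProdFinEquiv.injective h)) (fun p => hUc _)
    (fun p i => hZadj _ _ (e _).2) (fun p => hZadj _ _ (e _).2))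
  · intro i j h
    exact Fin.castSucc_injective t (e.injective (Subtype.ext h))
  · intro i h
    exact (Fin.castSucc_lt_last i).ne (e.injective (Subtype.ext h))

end Star

/-- If all cuts are large but the graph of heavy pairs is disconnected, there is a star. -/
theorem exists_hasStar_of_not_preconnected (t k m : ℕ) :
    ∃ M : ℕ, ∀ (V : Type*) [Fintype V] [DecidableEq V] (w : V → V → ℤ),
      (∀ x z, w x z = w z x) → (∀ x z, 0 ≤ w x z) →
      (∀ S : Finset V, S.Nonempty → Sᶜ.Nonempty → (M : ℤ) ≤ cutWeight w S) →
      ¬ (heavyGraph w m).Preconnected → HasStar w t k := by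
  -- Raising the threshold for heavy pairs above `t * k` makes the graph of heavy pairs smaller.
  refine ⟨2 ^ (t * k) * (t + 1) * (t * ((t + 1) * (k + 1) + 1)) ^ 2 * (m + t * k + 1) + 1,
    fun V _ _ w hs hw hcut hT => ?_⟩
  refine hasStar_of_large_cuts (m := ((m + t * k + 1 : ℕ) : ℤ)) (by push_cast; omega)
    (by positivity) hs hw (fun S h₁ h₂ => ?_) fun h => hT (h.mono fun x z hxz => ?_)
  · have := hcut S h₁ h₂
    push_cast at this ⊢
    omega
  · obtain ⟨h₁, h₂, h₃⟩ := hxz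
    push_cast at h₂ h₃
    have : (0 : ℤ) ≤ (t : ℤ) * k := by positivity
    exact ⟨h₁, by omega, by omega⟩

/-! ### Walks in multigraphs -/

section Walk

universe u₁ u₂

variable {γ : Type u₁} {δ : Type u₂} {G : Graph γ δ}

lemma support_eq_cons {u v : γ} (p : G.Walk u v) : p.support = u :: p.support.tail := by
  cases p <;> rfl

lemma start_mem_support {u v : γ} (p : G.Walk u v) : u ∈ p.support := by
  rw [support_eq_cons]
  exact List.mem_cons_self

lemma end_mem_support {u v : γ} (p : G.Walk u v) : v ∈ p.support := by
  induction p with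
  | nil => exact List.mem_cons_self
  | cons e h p ih => exact List.mem_cons_of_mem _ ih

lemma mem_vertexSet_of_mem_support {u v x : γ} (p : G.Walk u v) (hx : x ∈ p.support) :
    x ∈ V(G) := by
  induction p with
  | nil hu => obtain rfl := List.mem_singleton.1 hx; exact hu
  | cons e h p ih =>
    rcases List.mem_cons.1 hx with rfl | hx
    exacts [h.left_mem, ih hx]

lemma mem_support_of_inc {u v x : γ} {e : δ} (p : G.Walk u v) (he : e ∈ p.edges)
    (hx : G.Inc e x) : x ∈ p.support := by
  induction p with
  | nil => simp [Graph.Walk.edges] at he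
  | cons f h p ih =>
    rcases List.mem_cons.1 he with rfl | he
    · rcases hx.eq_or_eq_of_isLink h with rfl | rfl
      · exact List.mem_cons_self
      · exact List.mem_cons_of_mem _ (start_mem_support p)
    · exact List.mem_cons_of_mem _ (ih he)

lemma edges_nodup {u v : γ} {p : G.Walk u v} (hp : p.IsPath) : p.edges.Nodup := by
  induction p with
  | nil => exact List.nodup_nil
  | cons e h p ih =>
    obtain ⟨h₁, h₂⟩ := List.nodup_cons.1 hp
    exact List.nodup_cons.2 ⟨fun he => h₁ (mem_support_of_inc p he h.inc_left), ih h₂⟩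

lemma exists_append {u v w : γ} (p : G.Walk u v) (q : G.Walk v w) :
    ∃ r : G.Walk u w, r.support = p.support ++ q.support.tail ∧ r.edges = p.edges ++ q.edges := by
  induction p with
  | nil => exact ⟨q, support_eq_cons q, rfl⟩
  | cons e h p ih =>
    obtain ⟨r, h₁, h₂⟩ := ih q
    exact ⟨.cons e h r, by simp [Graph.Walk.support, h₁], by simp [Graph.Walk.edges, h₂]⟩

/-- A walk can be cut off at its first vertex in `S`. -/
lemma exists_prefix {u v : γ} (p : G.Walk u v) {S : γ → Prop} (hS : ∃ x ∈ p.support, S x) :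
    ∃ z, S z ∧ ∃ q : G.Walk u z, q.support <+: p.support ∧ q.edges <+: p.edges ∧
      ∀ x ∈ q.support, S x → x = z := by
  induction p with
  | @nil u hu =>
    obtain ⟨x, hx, hSx⟩ := hS
    obtain rfl := List.mem_singleton.1 hx
    exact ⟨x, hSx, .nil hu, List.prefix_rfl, List.prefix_rfl, fun y hy _ => List.mem_singleton.1 hy⟩
  | @cons u v w e h p ih =>
    by_cases hu : S u
    · exact ⟨u, hu, .nil h.left_mem, by simp [Graph.Walk.support],
        by simp [Graph.Walk.edges], fun y hy _ => List.mem_singleton.1 hy⟩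
    · obtain ⟨x, hx, hSx⟩ := hS
      rcases List.mem_cons.1 hx with rfl | hx
      · exact absurd hSx hu
      obtain ⟨z, hz, q, h₁, h₂, h₃⟩ := ih ⟨x, hx, hSx⟩
      refine ⟨z, hz, .cons e h q, by simpa [Graph.Walk.support] using h₁,
        by simpa [Graph.Walk.edges] using h₂, fun y hy hSy => ?_⟩
      rcases List.mem_cons.1 hy with rfl | hy
      · exact absurd hSy hu
      · exact h₃ y hy hSy

/-- Two edge-disjoint paths with the same distinct ends contain a cycle through their first
vertex: follow one path until it first meets the other one again, and return along the latter. -/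
lemma exists_isCycle {a b : γ} (hab : a ≠ b) {P Q : G.Walk a b} (hP : P.IsPath) (hQ : Q.IsPath)
    (hPQ : List.Disjoint P.edges Q.edges) :
    ∃ C : G.Walk a a, C.IsCycle ∧ ∀ e ∈ C.edges, e ∈ P.edges ∨ e ∈ Q.edges := by
  cases P with
  | nil => exact absurd rfl hab
  | @cons _ c _ e h P =>
    obtain ⟨haP, hP'⟩ := List.nodup_cons.1 hP
    obtain ⟨heP, heP'⟩ := List.nodup_cons.1 (edges_nodup hP)
    obtain ⟨z, hzQ, p, hp₁, hp₂, hp₃⟩ := exists_prefix P (S := fun x => x ∈ Q.support)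
      ⟨b, end_mem_support P, end_mem_support Q⟩
    obtain ⟨_, rfl, q, hq₁, hq₂, -⟩ := exists_prefix Q (S := fun x => x = z) ⟨z, hzQ, rfl⟩
    obtain ⟨q', hq₃, hq₄⟩ := q.exists_reverse
    obtain ⟨r, hr₁, hr₂⟩ := exists_append p q'
    have hq'nd : q'.support.Nodup := by
      rw [hq₃, List.nodup_reverse]
      exact hQ.sublist hq₁.sublist
    have hmemQ : ∀ f ∈ q'.edges, f ∈ Q.edges := fun f hf => by
      rw [hq₄, List.mem_reverse] at hf
      exact hq₂.subset hf
    have hmemP : ∀ f ∈ p.edges, f ∈ P.edges := fun f hf => hp₂.subset hf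
    refine ⟨.cons e h r, ⟨by simp [Graph.Walk.edges], ?_, ?_⟩, ?_⟩
    · simp only [Graph.Walk.edges, hr₂]
      refine List.nodup_cons.2 ⟨?_, List.Nodup.append (heP'.sublist hp₂.sublist) ?_ ?_⟩
      · intro he
        rcases List.mem_append.1 he with he | he
        · exact heP (hmemP e he)
        · exact hPQ List.mem_cons_self (hmemQ e he)
      · rw [hq₄, List.nodup_reverse]
        exact (edges_nodup hQ).sublist hq₂.sublist
      · intro f hf hf'
        exact hPQ (List.mem_cons_of_mem _ (hmemP f hf)) (hmemQ f hf')
    · simp only [Graph.Walk.support, hr₁, List.tail_cons]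
      rw [support_eq_cons q', List.nodup_cons] at hq'nd
      refine List.Nodup.append (hP'.sublist hp₁.sublist) hq'nd.2 ?_
      intro x hx hx'
      have hxQ : x ∈ Q.support := hq₁.subset (by
        have := List.mem_of_mem_tail hx'
        rwa [hq₃, List.mem_reverse] at this)
      exact hq'nd.1 (hp₃ x hx hxQ ▸ hx')
    · intro f hf
      simp only [Graph.Walk.edges, hr₂] at hf ⊢
      rcases List.mem_cons.1 hf with rfl | hf
      · exact Or.inl List.mem_cons_self
      rcases List.mem_append.1 hf with hf | hf
      · exact Or.inl (List.mem_cons_of_mem _ (hmemP f hf))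
      · exact Or.inr (hmemQ f hf)

/-- The subgraph of `G` with vertex set `S` and edge set `D`. -/
def subgraphOf (G : Graph γ δ) (S : Set γ) (D : Set δ) (h : ∀ e ∈ D, ∀ x, G.Inc e x → x ∈ S) :
    Graph γ δ where
  vertexSet := S
  IsLink e x y := e ∈ D ∧ G.IsLink e x y
  isLink_symm _ _ := ⟨fun _ _ h' => ⟨h'.1, h'.2.symm⟩⟩
  eq_or_eq_of_isLink_of_isLink _ _ _ _ _ h₁ h₂ := h₁.2.left_eq_or_eq h₂.2
  left_mem_of_isLink e x _ h' := h e h'.1 x h'.2.inc_left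

lemma exists_walk_subgraphOf {S : Set γ} {D : Set δ} {h : ∀ e ∈ D, ∀ x, G.Inc e x → x ∈ S}
    {u v : γ} (p : G.Walk u v) (hu : u ∈ S) (hp : ∀ e ∈ p.edges, e ∈ D) :
    ∃ q : (subgraphOf G S D h).Walk u v, q.support = p.support ∧ q.edges = p.edges := by
  induction p with
  | nil => exact ⟨.nil hu, rfl, rfl⟩
  | cons e he p ih =>
    have heD : e ∈ D := hp e List.mem_cons_self
    obtain ⟨q, h₁, h₂⟩ := ih (h e heD _ he.inc_right) fun f hf => hp f (List.mem_cons_of_mem _ hf)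
    exact ⟨.cons e ⟨heD, he⟩ q, by simp [Graph.Walk.support, h₁],
      by simp [Graph.Walk.edges, h₂]⟩

lemma nonempty_walk_to_end {u v x : γ} (p : G.Walk u v) (hx : x ∈ p.support) :
    Nonempty (G.Walk x v) := by
  induction p with
  | nil hu => obtain rfl := List.mem_singleton.1 hx; exact ⟨.nil hu⟩
  | cons e h p ih =>
    rcases List.mem_cons.1 hx with rfl | hx
    exacts [⟨.cons e h p⟩, ih hx]

end Walk

/-! ### Strong immersions from paths to a hub -/

section Immersion

universe u₁ u₂ u₃ u₄

variable {α : Type u₁} {β : Type u₂} {γ : Type u₃} {δ : Type u₄}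

/-- If the vertices of `F` can be joined to a hub by enough edge-disjoint paths, each of which
contains only one of them, then `F` is strongly immersed: an edge of `F` is represented by the union
of two paths from each of its ends, which for a loop contains a cycle. -/
theorem isStronglyImmersedIn_of_paths {F : Graph α β} {G : Graph γ δ} (y : V(F) → γ) (v : γ)
    (hy : Function.Injective y) (hyG : ∀ x, y x ∈ V(G)) (hv : v ∈ V(G)) (hyv : ∀ x, y x ≠ v)
    (P : ∀ (x : V(F)) (_ : E(F)) (_ : Bool), G.Walk (y x) v)
    (hP : ∀ x e b, (P x e b).IsPath)
    (hdisj : ∀ x e b x' e' b', (x, e, b) ≠ (x', e', b') →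
      List.Disjoint (P x e b).edges (P x' e' b').edges)
    (havoid : ∀ x e b x', y x' ∈ (P x e b).support → x' = x) :
    F.IsStronglyImmersedIn G := by
  let S : E(F) → Set γ := fun e => {z | z = v ∨ ∃ x : V(F), ∃ b, F.Inc e x ∧ z ∈ (P x e b).support}
  let D : E(F) → Set δ := fun e => {f | ∃ x : V(F), ∃ b, F.Inc e x ∧ f ∈ (P x e b).edges}
  have hSD : ∀ e, ∀ f ∈ D e, ∀ z, G.Inc f z → z ∈ S e := by
    rintro e f ⟨x, b, hx, hf⟩ z hz
    exact Or.inr ⟨x, b, hx, mem_support_of_inc _ hf hz⟩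
  have hstart : ∀ (e : E(F)) (x : V(F)), F.Inc e x → y x ∈ S e := fun e x hx =>
    Or.inr ⟨x, true, hx, start_mem_support _⟩
  have hwalk : ∀ e, ∀ z ∈ S e, Nonempty ((subgraphOf G (S e) (D e) (hSD e)).Walk z v) := by
    rintro e z (rfl | ⟨x, b, hx, hz⟩)
    · exact ⟨.nil (Or.inl rfl)⟩
    · obtain ⟨q, h₁, -⟩ := exists_walk_subgraphOf (h := hSD e) (P x e b) (hstart e x hx)
        fun f hf => ⟨x, b, hx, hf⟩
      exact nonempty_walk_to_end q (h₁ ▸ hz)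
  refine ⟨{
    vert := y
    edge := fun e => subgraphOf G (S e) (D e) (hSD e)
    vert_mem := hyG
    vert_injective := hy
    edge_le := fun e => ⟨?_, fun _ _ _ h => h.2⟩
    edge_isConnected := fun e => ⟨⟨v, Or.inl rfl⟩, fun a ha b hb => ?_⟩
    edge_disjoint := fun e e' hee => ?_
    vert_mem_edge := fun e x hx => hstart e x hx
    exists_isCycle := fun e x hx => ?_ }, ?_⟩
  · rintro z (rfl | ⟨x, b, -, hz⟩)
    exacts [hv, mem_vertexSet_of_mem_support _ hz]
  · obtain ⟨p⟩ := hwalk e a ha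
    obtain ⟨q⟩ := hwalk e b hb
    obtain ⟨q', -⟩ := q.exists_reverse
    obtain ⟨r, -⟩ := exists_append p q'
    exact ⟨r⟩
  · rw [Set.disjoint_left]
    rintro f ⟨_, _, ⟨x, b, -, hf⟩, -⟩ ⟨_, _, ⟨x', b', -, hf'⟩, -⟩
    exact hdisj x e b x' e' b' (by simp [hee]) hf hf'
  · have hdis := hdisj x e true x e false (by simp)
    obtain ⟨C, hC, hCe⟩ := exists_isCycle (hyv x) (hP x e true) (hP x e false) hdis
    obtain ⟨C', h₁, h₂⟩ := exists_walk_subgraphOf (h := hSD e) C (hstart e x hx.inc) (by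
      intro f hf
      rcases hCe f hf with hf | hf
      exacts [⟨x, true, hx.inc, hf⟩, ⟨x, false, hx.inc, hf⟩])
    refine ⟨C', ?_⟩
    rw [Graph.Walk.IsCycle, h₁, h₂]
    exact hC
  · rintro e x hx (h | ⟨x', b, hx', h⟩)
    · exact hyv x h
    · obtain rfl := havoid _ _ _ _ h
      exact hx hx'

end Immersion

/-! ### Reduction of a multigraph to a weighted graph on `X` -/

section Reduction

universe u₁ u₂

variable {γ : Type u₁} {δ : Type u₂} {G : Graph γ δ}

lemma linkCount_comm (x z : V(G)) : linkCount G x z = linkCount G z x := by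
  rw [linkCount, linkCount]
  congr 1
  ext e
  exact G.isLink_comm

/-- The weight function of `G` with all edges doubled, which makes all degrees even; loops are
discarded. -/
noncomputable def doubledCount (G : Graph γ δ) [DecidableEq V(G)] (x z : V(G)) : ℤ :=
  if x = z then 0 else 2 * linkCount G x z

lemma le_cutWeight_doubledCount [Fintype V(G)] [DecidableEq V(G)] {X : Set γ} {M : ℕ}
    (hconn : G.IsPairwiseEdgeConnected X M) (hE : E(G).Finite) {S : Finset V(G)}
    {u v : V(G)} (hu : (u : γ) ∈ X) (huS : u ∈ S) (hv : (v : γ) ∈ X) (hvS : v ∉ S) :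
    (2 * M : ℤ) ≤ cutWeight (doubledCount G) S := by
  have huv : (u : γ) ≠ v := fun h => hvS (Subtype.ext h ▸ huS)
  have h₁ := hconn u hu v hv huv
  push Not at h₁
  have hmem : ∀ x : V(G), (x : γ) ∈ (Subtype.val '' (S : Set V(G))) ↔ x ∈ S := fun x => by simp
  have h₂ := h₁ (Subtype.val '' (S : Set V(G))) (by rintro _ ⟨x, -, rfl⟩; exact x.2)
    ((hmem u).2 huS) (fun h => hvS ((hmem v).1 h))
  have hsub : G.edgeCut (Subtype.val '' (S : Set V(G))) ⊆
      ⋃ p ∈ S ×ˢ Sᶜ, {e | G.IsLink e (p.1 : γ) (p.2 : γ)} := by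
    rintro e ⟨x, z, he, hx, hz⟩
    have hx' := (hmem ⟨x, he.left_mem⟩).1 hx
    have hz' : (⟨z, he.right_mem⟩ : V(G)) ∈ Sᶜ :=
      Finset.mem_compl.2 fun h => hz ((hmem ⟨z, he.right_mem⟩).2 h)
    simp only [Set.mem_iUnion]
    exact ⟨(⟨x, he.left_mem⟩, ⟨z, he.right_mem⟩), Finset.mem_product.2 ⟨hx', hz'⟩, he⟩
  have hfin : (⋃ p ∈ S ×ˢ Sᶜ, {e | G.IsLink e (p.1 : γ) (p.2 : γ)}).Finite :=
    hE.subset fun e he => by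
      simp only [Set.mem_iUnion] at he
      obtain ⟨p, -, hp⟩ := he
      exact hp.edge_mem
  have h₃ : M ≤ ∑ p ∈ S ×ˢ Sᶜ, linkCount G p.1 p.2 := by
    have h₄ := h₂.trans (Set.encard_le_encard hsub)
    rw [← hfin.cast_ncard_eq] at h₄
    exact (Nat.cast_le.1 h₄).trans (Finset.set_ncard_biUnion_le _ _)
  rw [Finset.sum_product] at h₃
  have h₄ : cutWeight (doubledCount G) S = 2 * ((∑ x ∈ S, ∑ z ∈ Sᶜ, linkCount G x z : ℕ) : ℤ) := by
    push_cast
    simp only [cutWeight, Finset.mul_sum]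
    refine Finset.sum_congr rfl fun x hx => Finset.sum_congr rfl fun z hz => ?_
    rw [doubledCount, if_neg]
    rintro rfl
    exact Finset.mem_compl.1 hz hx
  rw [h₄]
  exact_mod_cast Nat.mul_le_mul_left 2 h₃

/-- The inclusion of `X` in the vertex set of `G`. -/
def inclusion {X : Set γ} (hX : X ⊆ V(G)) : X ↪ V(G) :=
  ⟨fun x => ⟨x, hX x.2⟩, fun _ _ h => Subtype.ext (congrArg (fun a : V(G) => (a : γ)) h)⟩

/-- Half of every integral flow below the weight function `w` on `X` can be realized in `G`, with
the outflows halved, no outflow at vertices outside `X`, and at most half of the absolute flow at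
each vertex of `X`. -/
def IsRealizable [Fintype V(G)] {X : Set γ} [Fintype X] (hX : X ⊆ V(G)) (w : X → X → ℤ) : Prop :=
  ∀ ψ : X → X → ℤ, IsFlow ψ → (∀ x z, ψ x z ≤ w x z) →
    ∃ φ : V(G) → V(G) → ℝ, IsFlow φ ∧ (∀ a b, φ a b ≤ linkCount G a b) ∧
      (∀ x, outflow φ (inclusion hX x) = ((outflow ψ x : ℤ) : ℝ) / 2) ∧
      (∀ a : V(G), (a : γ) ∉ X → outflow φ a = 0) ∧
      ∀ x, ∑ b, |φ (inclusion hX x) b| ≤ (∑ z, |(ψ x z : ℝ)|) / 2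

/-- After doubling the edges and splitting off all vertices outside `X`, there remains a weighted
graph on `X` with large cuts whose flows can be realized in `G`. -/
theorem exists_weights [Fintype V(G)] [DecidableEq V(G)] {X : Set γ} [Fintype X] [DecidableEq X]
    (hE : E(G).Finite) (hX : X ⊆ V(G)) {M : ℕ} (hconn : G.IsPairwiseEdgeConnected X M) :
    ∃ w : X → X → ℤ, (∀ x z, w x z = w z x) ∧ (∀ x z, 0 ≤ w x z) ∧
      (∀ S : Finset X, S.Nonempty → Sᶜ.Nonempty → (M : ℤ) ≤ cutWeight w S) ∧
      IsRealizable hX w := by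
  classical
  let ι := inclusion hX
  let Y : Finset V(G) := Finset.univ.map ι
  have hY : ∀ a : V(G), a ∈ Y ↔ (a : γ) ∈ X := fun a => by
    constructor
    · intro h
      obtain ⟨x, -, rfl⟩ := Finset.mem_map.1 h
      exact x.2
    · exact fun h => Finset.mem_map.2 ⟨⟨a, h⟩, Finset.mem_univ _, rfl⟩
  have hιY : ∀ x, ι x ∈ Y := fun x => Finset.mem_map_of_mem ι (Finset.mem_univ x)
  have hsymm : ∀ a b : V(G), doubledCount G a b = doubledCount G b a := fun a b => by
    simp only [doubledCount, linkCount_comm a b, eq_comm]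
  obtain ⟨w, hw, hw0⟩ := IsReduction.exists_supported (μ := doubledCount G) (X := Y)
    (k := 2 * M) (even_two_mul _) (w := doubledCount G)
    { symm := hsymm
      nonneg := fun a b => by
        simp only [doubledCount]
        split_ifs <;> positivity
      diag := fun a => by simp [doubledCount]
      even := fun a => Finset.even_sum _ fun b _ => by
        simp only [doubledCount]
        split_ifs
        exacts [Even.zero, even_two_mul _]
      cut := by
        rintro S ⟨⟨u, hu, huS⟩, v, hv, hvS⟩
        exact le_cutWeight_doubledCount hconn hE ((hY u).1 hu) huS ((hY v).1 hv) hvS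
      lifts := fun ψ h₁ h₂ => ⟨ψ, h₁, h₂, fun _ => rfl, fun _ _ => le_rfl⟩ }
  have hsum : ∀ {N : Type} [AddCommMonoid N] (f : V(G) → N), (∀ b ∉ Y, f b = 0) →
      ∑ b, f b = ∑ x, f (ι x) := fun f hf => by
    rw [← Finset.sum_map Finset.univ ι f]
    exact (Finset.sum_subset (Finset.subset_univ _) fun b _ hb => hf b hb).symm
  refine ⟨fun x z => w (ι x) (ι z), fun x z => hw.symm _ _, fun x z => hw.nonneg _ _, ?_, ?_⟩
  · rintro S ⟨u, hu⟩ ⟨v, hv⟩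
    have h₁ := hw.cut (S.map ι) ⟨⟨ι u, hιY u, Finset.mem_map_of_mem ι hu⟩, ι v, hιY v, fun h =>
      Finset.mem_compl.1 hv ((Finset.mem_map' ι).1 h)⟩
    have h₂ : cutWeight w (S.map ι) = cutWeight (fun x z => w (ι x) (ι z)) S := by
      rw [cutWeight, cutWeight, Finset.sum_map]
      refine Finset.sum_congr rfl fun x _ => ?_
      rw [← Finset.sum_map Sᶜ ι fun b => w (ι x) b]
      refine (Finset.sum_subset (fun b hb => ?_) fun b hb hb' => ?_).symm
      · obtain ⟨z, hz, rfl⟩ := Finset.mem_map.1 hb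
        rw [Finset.mem_compl, Finset.mem_map']
        exact Finset.mem_compl.1 hz
      · rw [hw.symm]
        refine hw0 _ _ fun hbY => ?_
        obtain ⟨z, -, rfl⟩ := Finset.mem_map.1 hbY
        rw [Finset.mem_compl, Finset.mem_map'] at hb
        exact hb' (Finset.mem_map_of_mem ι (Finset.mem_compl.2 hb))
    rw [← h₂]
    omega
  · intro ψ hψ hle
    let ext : V(G) → V(G) → ℝ := fun a b =>
      if h : (a : γ) ∈ X ∧ (b : γ) ∈ X then (ψ ⟨a, h.1⟩ ⟨b, h.2⟩ : ℝ) else 0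
    have hext : ∀ x z, ext (ι x) (ι z) = ψ x z := fun x z => dif_pos ⟨x.2, z.2⟩
    have hext₁ : ∀ a b : V(G), (a : γ) ∉ X → ext a b = 0 := fun a b h => dif_neg fun h' => h h'.1
    have hext₂ : ∀ a b : V(G), (b : γ) ∉ X → ext a b = 0 := fun a b h => dif_neg fun h' => h h'.2
    obtain ⟨φ, h₁, h₂, h₃, h₄⟩ := hw.lifts ext (fun a b => by
      simp only [ext]
      by_cases h : (a : γ) ∈ X ∧ (b : γ) ∈ X
      · rw [dif_pos h, dif_pos h.symm, hψ]; push_cast; rfl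
      · rw [dif_neg h, dif_neg fun h' => h h'.symm, neg_zero]) (fun a b => by
      simp only [ext]
      split_ifs with h
      · exact_mod_cast hle ⟨a, h.1⟩ ⟨b, h.2⟩
      · exact_mod_cast hw.nonneg a b)
    refine ⟨fun a b => φ a b / 2, fun a b => ?_, fun a b => ?_, fun x => ?_, fun a ha => ?_,
      fun x => ?_⟩
    · dsimp only
      rw [h₁ a b]; ring
    · have h₅ := h₂ a b
      have h₆ : doubledCount G a b ≤ 2 * linkCount G a b := by
        rw [doubledCount]
        split_ifs <;> omega
      have h₇ : ((doubledCount G a b : ℤ) : ℝ) ≤ 2 * linkCount G a b := by exact_mod_cast h₆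
      dsimp only
      linarith
    · have h₅ := h₃ (ι x)
      rw [outflow, ← Finset.sum_div]
      congr 1
      refine h₅.trans ?_
      rw [outflow, hsum _ fun b hb => hext₂ _ b fun h => hb ((hY b).2 h), outflow]
      push_cast
      exact Finset.sum_congr rfl fun z _ => hext x z
    · rw [outflow, ← Finset.sum_div]
      have h₅ := h₃ a
      rw [show outflow ext a = 0 from Finset.sum_eq_zero fun b _ => hext₁ a b ha] at h₅
      rw [show ∑ b, φ a b = 0 from h₅, zero_div]
    · have h₅ := h₄ (ι x) (hιY x)
      rw [hsum (fun b => |ext (ι x) b|) fun b hb => by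
        rw [hext₂ _ b fun h => hb ((hY b).2 h), abs_zero]] at h₅
      simp only [hext] at h₅
      simp only [abs_div, abs_two, ← Finset.sum_div]
      linarith

lemma demand_inclusion {X : Set γ} [DecidableEq V(G)] [DecidableEq X] (hX : X ⊆ V(G))
    (u v x : X) : demand (inclusion hX u) (inclusion hX v) (inclusion hX x) = demand u v x := by
  simp only [demand, (inclusion hX).apply_eq_iff_eq]

lemma demand_of_notMem {X : Set γ} [DecidableEq V(G)] (hX : X ⊆ V(G)) (u v : X) {a : V(G)}
    (ha : (a : γ) ∉ X) : demand (inclusion hX u) (inclusion hX v) a = 0 := by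
  have h : ∀ x : X, a ≠ inclusion hX x := by
    rintro x rfl
    exact ha x.2
  simp [demand, h]

/-- A pair of vertices of weight at least `2 * m` is joined by `m` edge-disjoint paths that avoid the rest
of `X`. -/
lemma hasPathsAvoiding_of_le_weight [Fintype V(G)] [DecidableEq V(G)] {X : Set γ} [Fintype X]
    [DecidableEq X] (hE : E(G).Finite) (hX : X ⊆ V(G)) {w : X → X → ℤ} (hw : ∀ x z, 0 ≤ w x z)
    (hreal : IsRealizable hX w) {m : ℕ} {u v : X} (huv : u ≠ v) (h : (2 * m : ℤ) ≤ w u v) :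
    G.HasPathsAvoiding X m u v := by
  obtain ⟨φ, h₁, h₂, h₃, h₄, h₅⟩ := hreal (fun x z => 2 * m * arc u v x z)
    (fun x z => by
      have := isFlow_arc u v x z
      dsimp only
      rw [this, mul_neg])
    (fun x z => by
      by_cases h' : x = u ∧ z = v
      · obtain ⟨rfl, rfl⟩ := h'
        simpa [arc, huv] using h
      · have h₀ := hw x z
        have : arc u v x z ≤ 0 := by
          simp only [arc, h', if_false]
          split_ifs <;> simp
        nlinarith)
  have hne : inclusion hX u ≠ inclusion hX v := fun h => huv ((inclusion hX).injective h)
  obtain ⟨P, hP, hdisj, hmem⟩ := exists_paths_of_flow hE (fun _ : Fin m => inclusion hX u)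
    (inclusion hX v) (fun _ => hne) φ h₁ h₂ (fun a => by
      rw [Finset.sum_const, Finset.card_univ, Fintype.card_fin, nsmul_eq_mul]
      by_cases ha : (a : γ) ∈ X
      · obtain ⟨x, rfl⟩ : ∃ x, inclusion hX x = a := ⟨⟨a, ha⟩, rfl⟩
        have : outflow (fun x z => 2 * (m : ℤ) * arc u v x z) x = 2 * m * demand u v x := by
          rw [← outflow_arc, outflow, outflow, Finset.mul_sum]
        rw [h₃, this, demand_inclusion]
        push_cast
        ring
      · rw [h₄ a ha, demand_of_notMem hX u v ha, Int.cast_zero, mul_zero])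
  refine ⟨P, hP, hdisj, fun i x hx hxX => ?_⟩
  by_contra! hxuv
  obtain ⟨y, rfl⟩ : ∃ y : X, (y : γ) = x := ⟨⟨x, hxX⟩, rfl⟩
  have hyu : y ≠ u := fun h => hxuv.1 (congrArg _ h)
  have hyv : y ≠ v := fun h => hxuv.2 (congrArg _ h)
  rcases hmem i (inclusion hX y) hx with h | ⟨a, ha⟩
  · exact hyu ((inclusion hX).injective h)
  · -- The flow does not use the other vertices of `X` at all.
    have h₆ := h₅ y
    have h₇ : ∑ z, |((2 * m * arc u v y z : ℤ) : ℝ)| = 0 := by simp [arc, hyu, hyv]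
    rw [h₇, zero_div] at h₆
    have h₈ := (Finset.single_le_sum (f := fun b => |φ (inclusion hX y) b|)
      (fun b _ => abs_nonneg _) (Finset.mem_univ a)).trans h₆
    have h₉ := abs_nonpos_iff.1 h₈
    rw [h₁, h₉, neg_zero] at ha
    exact lt_irrefl _ ha

/-- A star with enough flow from as many sources as `F` has vertices is a strong immersion of `F`.
The flow does not enter its sources, hence neither do the paths into which it decomposes. -/
lemma isStronglyImmersedIn_of_hasStar {α : Type*} {β : Type*} {F : Graph α β} [Fintype V(F)]
    [Fintype E(F)] [Fintype V(G)] [DecidableEq V(G)] {X : Set γ} [Fintype X] [DecidableEq X]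
    (hE : E(G).Finite) (hX : X ⊆ V(G)) {w : X → X → ℤ} (hreal : IsRealizable hX w)
    (hstar : HasStar w (Fintype.card V(F)) (2 * Fintype.card (E(F) × Bool))) :
    F.IsStronglyImmersedIn G := by
  obtain ⟨y, v, ψ, hy, hyv, hψ, hle, hout, hpos⟩ := hstar
  obtain ⟨φ, h₁, h₂, h₃, h₄, h₅⟩ := hreal ψ hψ hle
  let eV := Fintype.equivFin V(F)
  let eE := Fintype.equivFin (E(F) × Bool)
  -- At a source the absolute flow is at most the outflow, so all flow there leaves the source.
  have hneg : ∀ i a, φ a (inclusion hX (y i)) ≤ 0 := by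
    intro i a
    have h₆ : ∑ b, |φ (inclusion hX (y i)) b| ≤ ∑ b, φ (inclusion hX (y i)) b := by
      refine (h₅ (y i)).trans_eq (Eq.trans ?_ (h₃ (y i)).symm)
      rw [outflow]
      push_cast
      congr 1
      exact Finset.sum_congr rfl fun z _ => abs_of_nonneg (by exact_mod_cast hpos i z)
    have h₇ := (Finset.sum_eq_sum_iff_of_le fun b _ => le_abs_self _).1
      (le_antisymm (Finset.sum_le_sum fun b _ => le_abs_self _) h₆) a (Finset.mem_univ a)
    have h₈ := abs_nonneg (φ (inclusion hX (y i)) a)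
    rw [h₁]
    linarith
  obtain ⟨P, hP, hdisj, hmem⟩ := exists_paths_of_flow hE
    (fun p : Fin (Fintype.card V(F)) × Fin (Fintype.card (E(F) × Bool)) => inclusion hX (y p.1))
    (inclusion hX v) (fun p h => hyv p.1 ((inclusion hX).injective h)) φ h₁ h₂ (fun a => by
      by_cases ha : (a : γ) ∈ X
      · obtain ⟨x, rfl⟩ : ∃ x, inclusion hX x = a := ⟨⟨a, ha⟩, rfl⟩
        simp only [h₃, hout, demand_inclusion, Fintype.sum_prod_type, Finset.sum_const,
          Finset.card_univ, Fintype.card_fin, nsmul_eq_mul]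
        push_cast
        rw [Finset.sum_div]
        exact Finset.sum_congr rfl fun i _ => by ring
      · simp [h₄ a ha, demand_of_notMem hX _ _ ha])
  refine isStronglyImmersedIn_of_paths (fun x => (y (eV x) : γ)) (v : γ)
    (fun x x' h => eV.injective (hy (Subtype.ext h))) (fun x => hX (y (eV x)).2) (hX v.2)
    (fun x h => hyv _ (Subtype.ext h)) (fun x e b => P (eV x, eE (e, b)))
    (fun x e b => hP _) (fun x e b x' e' b' hne => hdisj _ _ fun h => hne ?_)
    (fun x e b x' hx' => ?_)
  · rw [Prod.mk.injEq] at h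
    have h₆ := eV.injective h.1
    have h₇ := Prod.mk.inj (eE.injective h.2)
    rw [h₆, h₇.1, h₇.2]
  · rcases hmem (eV x, eE (e, b)) (inclusion hX (y (eV x'))) hx' with h | ⟨a, ha⟩
    · exact eV.injective (hy ((inclusion hX).injective h))
    · exact absurd ha (not_lt.2 (hneg _ a))

end Reduction

end StrongImmersion

open StrongImmersion

theorem theorem6 {α β : Type*} (F : Graph α β)
    (hFV : V(F).Finite) (hFE : E(F).Finite) (m : ℕ) :
    ∃ M : ℕ, ∀ (γ δ : Type*) (G : Graph γ δ) (X : Set γ),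
      V(G).Finite → E(G).Finite → X ⊆ V(G) → X.Nonempty →
      G.IsPairwiseEdgeConnected X M → ¬ F.IsStronglyImmersedIn G →
      (G.pathGraph X m).Connected := by
  classical
  have := hFV.fintype
  have := hFE.fintype
  obtain ⟨M, hM⟩ := exists_hasStar_of_not_preconnected (Fintype.card V(F))
    (2 * Fintype.card (E(F) × Bool)) (2 * m)
  refine ⟨M, fun γ δ G X hGV hGE hX hXne hconn hF => ?_⟩
  have := hGV.fintype
  have := (hGV.subset hX).fintype
  obtain ⟨w, hs, hw, hcut, hreal⟩ := exists_weights hGE hX hconn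
  have hle : heavyGraph w (2 * m : ℕ) ≤ G.pathGraph X m := fun u v h =>
    ⟨h.1, hasPathsAvoiding_of_le_weight hGE hX hw hreal h.1 (by exact_mod_cast h.2.1)⟩
  have hpre : (heavyGraph w (2 * m : ℕ)).Preconnected := by
    by_contra hT
    exact hF (isStronglyImmersedIn_of_hasStar hGE hX hreal (hM X w hs hw hcut hT))
  have := hXne.to_subtype
  exact ⟨hpre.mono hle⟩
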